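/- Let $N\ge 1$ and let $g(t)=\sum_{k=1}^N \frac{a_k}{t-iw_k}$, $t\in\mathbb{R}$, where $a_k,w_k\in\mathbb{C}$, $a_k\ne 0$ and $\operatorname{Re} w_k\ne 0$ for all $k$, and $\operatorname{Re} w_k\ne\operatorname{Re} w_l$ for $k\ne l$. Then, for all $\alpha,\beta>0$, the Gabor system $$\mathcal{G}(g;\alpha,\beta)=\{e^{2\pi i\beta n t}g(t-\alpha m):\ m,n\in\mathbb{Z}\}$$ is complete in $L^2(\mathbb{R})$ (that is, its complex linear span is dense in the space of complex-valued square-integrable functions) if and only if $\alpha\beta\le 1$. -/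

import Mathlib

open MeasureTheory

noncomputable section

/-- The time-frequency shift `π_{x,y} g (t) = e^{2πiyt} g(t - x)`. -/
def timeFreqShift (x y : ℝ) (g : ℝ → ℂ) (t : ℝ) : ℂ :=
  Complex.exp (2 * Real.pi * Complex.I * y * t) * g (t - x)

theorem memLp_timeFreqShift {g : ℝ → ℂ} (hg : MemLp g 2 volume) (x y : ℝ) :
    MemLp (timeFreqShift x y g) 2 volume := by
  have h1 : MemLp (fun t : ℝ => g (t - x)) 2 volume :=
    hg.comp_measurePreserving (measurePreserving_sub_right volume x)
  refine h1.of_le (f := timeFreqShift x y g) ?_ (Filter.Eventually.of_forall fun t => ?_)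
  · have hc : Continuous fun t : ℝ => Complex.exp (2 * Real.pi * Complex.I * y * t) := by
      fun_prop
    exact hc.aestronglyMeasurable.mul h1.1
  · have h2 : (2 * Real.pi * Complex.I * y * t : ℂ) = ((2 * Real.pi * y * t : ℝ) : ℂ) * Complex.I := by
      push_cast; ring
    simp only [timeFreqShift]
    rw [norm_mul, h2, Complex.norm_exp_ofReal_mul_I, one_mul]

/-- The Gabor system `{π_{αm, βn} g : m, n ∈ ℤ}`, as a subset of `L²(ℝ)` (complex valued). -/
def gaborSystem (g : ℝ → ℂ) (hg : MemLp g 2 volume) (α β : ℝ) :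
    Set (Lp ℂ 2 (volume : Measure ℝ)) :=
  Set.range fun p : ℤ × ℤ => (memLp_timeFreqShift hg (α * p.1) (β * p.2)).toLp

/-- A set of vectors in `L²(ℝ)` is complete if its linear span is dense in `L²(ℝ)`. -/
def IsCompleteSystem (S : Set (Lp ℂ 2 (volume : Measure ℝ))) : Prop :=
  (Submodule.span ℂ S).topologicalClosure = ⊤

/-- The rational function `g(t) = ∑ₖ aₖ / (t - i wₖ)`. -/
def rationalWindow {N : ℕ} (a w : Fin N → ℂ) (t : ℝ) : ℂ :=
  ∑ k, a k / ((t : ℂ) - Complex.I * w k)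

theorem sub_I_mul_ne_zero {w : ℂ} (hw : w.re ≠ 0) (t : ℝ) : (t : ℂ) - Complex.I * w ≠ 0 := by
  intro h
  apply hw
  simpa using congrArg Complex.im h

theorem memLp_rationalWindow {N : ℕ} (a w : Fin N → ℂ) (hw : ∀ k, (w k).re ≠ 0) :
    MemLp (rationalWindow a w) 2 volume := by
  refine memLp_finsetSum (f := fun k (t : ℝ) => a k / ((t : ℂ) - Complex.I * w k)) _ fun k _ => ?_
  have hc : Continuous fun t : ℝ => ((t : ℂ) - Complex.I * w k)⁻¹ :=
    Continuous.inv₀ (by fun_prop) (sub_I_mul_ne_zero (hw k))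
  simp only [div_eq_mul_inv]
  refine MemLp.const_mul ?_ (a k)
  rw [memLp_two_iff_integrable_sq_norm hc.aestronglyMeasurable]
  have h0 : Integrable (fun t : ℝ => ((w k).re ^ 2)⁻¹ *
      (1 + ((t + (w k).im) / (w k).re) ^ 2)⁻¹) volume :=
    ((integrable_inv_one_add_sq.comp_div (hw k)).comp_add_right (w k).im).const_mul _
  refine h0.congr (Filter.Eventually.of_forall fun t => ?_)
  have hr := hw k
  have h2 : ‖(t : ℂ) - Complex.I * w k‖ ^ 2 = (t + (w k).im) ^ 2 + (w k).re ^ 2 := by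
    rw [← Complex.normSq_eq_norm_sq, Complex.normSq_apply]
    simp
    ring
  simp only [norm_inv, inv_pow, h2]
  rw [← mul_inv]
  congr 1
  field_simp
  ring

end

/-! On the Fourier side each summand of the window is an exponential on a half line, and
completeness becomes uniqueness: no nonzero `H` in L² annihilates all modulations, with frequencies
`α m`, of all `β`-translates of `freqWindow` (`isCompleteSystem_gabor_iff`). Write T = 1/α and q_k =
exp(-2πβ w_k).

Let αβ ≤ 1. Applying ∏(1 - q_k S), with S the translation by β, cancels the exponential tails and
leaves the compactly supported `compactWindow`. Vanishing Fourier coefficients then say that for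
almost every x the fiber y_n = H(x + nT) solves a banded system, one equation for each translate of
`compactWindow`. If T = β, this is a convolution equation with a nonzero polynomial, and y tends to
0 because H is in L²; hence y = 0 (`eq_zero_of_tsum_compactWindow_eq_zero_of_tendsto`). If T > β,
the cells of length β met by the points x + nT leave infinitely many gaps. Freeze the cell pattern
of a finite section and let x tend to infinity in the matrix entries: the exponential with smallest
Re w dominates. A null vector of the limit matrix, placed at the occupied cells, is a combination of
geometric sequences vanishing at the gaps; as their ratios have distinct moduli, it is zero.
Analyticity in x carries injectivity over to almost every x
(`ae_eq_zero_of_tsum_compactWindow_eq_zero`).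

Let αβ > 1, so T < β. Annihilating all translates by L pieces spaced by T costs about N + LT/β
linear conditions, fewer than L when L is large. A nontrivial solution analytic in x, cut off to a
short interval and glued along the T-translates, is a nonzero `H` (`exists_orthogonal_ne_zero`). -/

noncomputable section

open scoped FourierTransform SchwartzMap

/-! ### The window and its time-frequency shifts on the Fourier side. -/

/-- On `L¹ ∩ L²` the `L²`-Fourier transform is given by the Fourier integral. -/
theorem fourier_toLp_eq_of_integrable {f F : ℝ → ℂ} (hf : Integrable f) (hf2 : MemLp f 2 volume)
    (hF2 : MemLp F 2 volume) (h : ∀ t, 𝓕 f t = F t) : 𝓕 (hf2.toLp) = hF2.toLp := by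
  -- Both sides are compared as tempered distributions, where the claim is the symmetry of the
  -- Fourier integral against a test function.
  have hinj := LinearMap.ker_eq_bot.mp
    (MeasureTheory.Lp.ker_toTemperedDistributionCLM_eq_bot (E := ℝ) (F := ℂ) (μ := volume) (p := 2))
  apply hinj
  change ((𝓕 (hf2.toLp) : Lp ℂ 2 (volume : Measure ℝ)) : 𝓢'(ℝ, ℂ)) = ((hF2.toLp : Lp ℂ 2 (volume : Measure ℝ)) : 𝓢'(ℝ, ℂ))
  rw [← MeasureTheory.Lp.fourier_toTemperedDistribution_eq]
  ext ψ
  rw [TemperedDistribution.fourier_apply, MeasureTheory.Lp.toTemperedDistribution_apply,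
    MeasureTheory.Lp.toTemperedDistribution_apply]
  have h1 : ∫ x, (𝓕 ψ) x • (hf2.toLp f) x = ∫ x, (𝓕 ψ) x • f x :=
    integral_congr_ae (by filter_upwards [hf2.coeFn_toLp] with x hx; rw [hx])
  have h2 : ∫ x, ψ x • (hF2.toLp F) x = ∫ x, ψ x • F x :=
    integral_congr_ae (by filter_upwards [hF2.coeFn_toLp] with x hx; rw [hx])
  rw [h1, h2]
  have h3 := VectorFourier.integral_fourierIntegral_smul_eq_flip (L := innerₗ ℝ)
    (μ := volume) (ν := volume) Real.continuous_fourierChar continuous_inner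
    (f := ψ) (g := f) ψ.integrable hf
  rw [flip_innerₗ] at h3
  have h4 : ∀ x, VectorFourier.fourierIntegral Real.fourierChar volume (innerₗ ℝ) f x = F x := h
  simp_rw [h4] at h3
  exact h3

/-- The function whose Fourier transform is `t ↦ (2 π i (t - i w))⁻¹`: a decaying exponential
supported on a half line. -/
def halfLineExp (w : ℂ) (ξ : ℝ) : ℂ :=
  ((if 0 < ξ then 1 else 0) - (if 0 < w.re then 0 else 1)) *
    Complex.exp (-(2 * Real.pi * w) * ξ)

theorem halfLineExp_of_pos {w : ℂ} (hw : 0 < w.re) :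
    halfLineExp w = (Set.Ioi (0 : ℝ)).indicator fun ξ => Complex.exp (-(2 * Real.pi * w) * ξ) := by
  ext ξ
  by_cases h : 0 < ξ <;> simp [halfLineExp, hw, h]

theorem halfLineExp_of_not_pos {w : ℂ} (hw : ¬ 0 < w.re) :
    halfLineExp w = (Set.Iic (0 : ℝ)).indicator fun ξ => -Complex.exp (-(2 * Real.pi * w) * ξ) := by
  ext ξ
  by_cases h : 0 < ξ
  · simp [halfLineExp, hw, h, h.not_ge]
  · simp [halfLineExp, hw, h, not_lt.mp h]

theorem integrable_halfLineExp {w : ℂ} (hw : w.re ≠ 0) : Integrable (halfLineExp w) := by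
  by_cases h : 0 < w.re
  · rw [halfLineExp_of_pos h, integrable_indicator_iff measurableSet_Ioi]
    refine integrableOn_exp_mul_complex_Ioi ?_ 0
    have := mul_pos Real.two_pi_pos h
    simpa using this
  · rw [halfLineExp_of_not_pos h, integrable_indicator_iff measurableSet_Iic]
    refine (integrableOn_exp_mul_complex_Iic ?_ 0).neg
    have := mul_pos Real.two_pi_pos (neg_pos.mpr (lt_of_le_of_ne (not_lt.mp h) hw))
    simpa using this

theorem norm_halfLineExp_le (w : ℂ) (ξ : ℝ) : ‖halfLineExp w ξ‖ ≤ 1 := by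
  by_cases h : 0 < w.re
  · rw [halfLineExp_of_pos h]
    by_cases hξ : ξ ∈ Set.Ioi (0 : ℝ)
    · rw [Set.indicator_of_mem hξ, Complex.norm_exp, Real.exp_le_one_iff]
      have := mul_pos (mul_pos Real.two_pi_pos h) hξ
      simpa using this.le
    · rw [Set.indicator_of_notMem hξ]; simp
  · rw [halfLineExp_of_not_pos h]
    by_cases hξ : ξ ∈ Set.Iic (0 : ℝ)
    · rw [Set.indicator_of_mem hξ, norm_neg, Complex.norm_exp, Real.exp_le_one_iff]
      have := mul_nonneg_of_nonpos_of_nonpos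
        (mul_nonpos_of_nonneg_of_nonpos Real.two_pi_pos.le (not_lt.mp h)) hξ
      simpa using this
    · rw [Set.indicator_of_notMem hξ]; simp

theorem integral_fourier_halfLineExp {w : ℂ} (hw : w.re ≠ 0) (t : ℝ) :
    ∫ ξ : ℝ, Complex.exp (-(2 * Real.pi * Complex.I * t) * ξ) * halfLineExp w ξ =
      (2 * Real.pi * Complex.I * (t - Complex.I * w))⁻¹ := by
  have hI : 2 * Real.pi * Complex.I * (t - Complex.I * w) =
      -(-(2 * Real.pi * (w + Complex.I * t))) := by
    linear_combination (-2 * Real.pi * w) * Complex.I_sq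
  have hexp : ∀ ξ : ℝ, Complex.exp (-(2 * Real.pi * Complex.I * t) * ξ) *
      Complex.exp (-(2 * Real.pi * w) * ξ) =
      Complex.exp (-(2 * Real.pi * (w + Complex.I * t)) * ξ) := fun ξ => by
    rw [← Complex.exp_add]; congr 1; ring
  by_cases h : 0 < w.re
  · rw [halfLineExp_of_pos h]
    simp_rw [← Set.indicator_mul_right _ (fun ξ : ℝ => Complex.exp (-(2 * Real.pi * Complex.I * t) * ξ)), hexp]
    rw [integral_indicator measurableSet_Ioi, integral_exp_mul_complex_Ioi, hI]
    · simp [div_eq_mul_inv]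
    · have := mul_pos Real.two_pi_pos h
      simpa using this
  · rw [halfLineExp_of_not_pos h]
    simp_rw [← Set.indicator_mul_right _ (fun ξ : ℝ => Complex.exp (-(2 * Real.pi * Complex.I * t) * ξ)), mul_neg, hexp]
    rw [integral_indicator measurableSet_Iic, integral_neg, integral_exp_mul_complex_Iic, hI]
    · simp [div_eq_mul_inv]
    · have := mul_pos Real.two_pi_pos (neg_pos.mpr (lt_of_le_of_ne (not_lt.mp h) hw))
      simpa using this

/-- The inverse Fourier transform of the rational window. -/
def freqWindow {N : ℕ} (a w : Fin N → ℂ) (ξ : ℝ) : ℂ :=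
  ∑ k, 2 * Real.pi * Complex.I * a k * halfLineExp (w k) ξ

theorem integrable_freqWindow {N : ℕ} (a w : Fin N → ℂ) (hw : ∀ k, (w k).re ≠ 0) :
    Integrable (freqWindow a w) :=
  integrable_finsetSum _ fun k _ => (integrable_halfLineExp (hw k)).const_mul _

theorem exists_norm_freqWindow_le {N : ℕ} (a w : Fin N → ℂ) :
    ∃ C, ∀ ξ, ‖freqWindow a w ξ‖ ≤ C := by
  refine ⟨∑ k, ‖2 * Real.pi * Complex.I * a k‖, fun ξ => norm_sum_le_of_le _ fun k _ => ?_⟩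
  rw [norm_mul]
  exact mul_le_of_le_one_right (norm_nonneg _) (norm_halfLineExp_le _ _)

theorem memLp_two_of_integrable_of_bounded {f : ℝ → ℂ} (hf : Integrable f) {C : ℝ}
    (hC : ∀ x, ‖f x‖ ≤ C) : MemLp f 2 volume := by
  rw [memLp_two_iff_integrable_sq_norm hf.1]
  refine (hf.norm.const_mul C).mono' (hf.1.norm.pow 2) (Filter.Eventually.of_forall fun x => ?_)
  rw [Real.norm_of_nonneg (by positivity), pow_two]
  exact mul_le_mul_of_nonneg_right (hC x) (norm_nonneg _)

theorem integral_fourier_freqWindow {N : ℕ} (a w : Fin N → ℂ) (hw : ∀ k, (w k).re ≠ 0) (t : ℝ) :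
    ∫ ξ : ℝ, Complex.exp (-(2 * Real.pi * Complex.I * t) * ξ) * freqWindow a w ξ =
      rationalWindow a w t := by
  have hint : ∀ k, Integrable fun ξ : ℝ =>
      Complex.exp (-(2 * Real.pi * Complex.I * t) * ξ) * halfLineExp (w k) ξ := fun k => by
    refine (integrable_halfLineExp (hw k)).bdd_mul (c := 1)
      (by fun_prop : Continuous fun ξ : ℝ => Complex.exp (-(2 * Real.pi * Complex.I * t) * ξ)).aestronglyMeasurable
      (Filter.Eventually.of_forall fun ξ => ?_)
    rw [Complex.norm_exp]; simp
  simp only [freqWindow, Finset.mul_sum, mul_left_comm (Complex.exp _)]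
  rw [integral_finsetSum _ fun k _ => (hint k).const_mul _]
  refine Finset.sum_congr rfl fun k _ => ?_
  rw [integral_const_mul, integral_fourier_halfLineExp (hw k)]
  have := sub_I_mul_ne_zero (hw k) t
  have hpi : (Real.pi : ℂ) ≠ 0 := by exact_mod_cast Real.pi_ne_zero
  field_simp [Complex.I_ne_zero]

/-- The inverse Fourier transform of the time-frequency shift `π_{x,y}` of the rational window. -/
def freqAtom {N : ℕ} (a w : Fin N → ℂ) (x y ξ : ℝ) : ℂ :=
  Complex.exp (2 * Real.pi * Complex.I * x * (ξ + y : ℝ)) * freqWindow a w (ξ + y)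

theorem norm_freqAtom {N : ℕ} (a w : Fin N → ℂ) (x y ξ : ℝ) :
    ‖freqAtom a w x y ξ‖ = ‖freqWindow a w (ξ + y)‖ := by
  have h2 : (2 * Real.pi * Complex.I * x * (ξ + y : ℝ) : ℂ) =
      ((2 * Real.pi * x * (ξ + y) : ℝ) : ℂ) * Complex.I := by
    push_cast; ring
  rw [freqAtom, norm_mul, h2, Complex.norm_exp_ofReal_mul_I, one_mul]

theorem integrable_freqAtom {N : ℕ} (a w : Fin N → ℂ) (hw : ∀ k, (w k).re ≠ 0) (x y : ℝ) :
    Integrable (freqAtom a w x y) := by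
  refine ((integrable_freqWindow a w hw).comp_add_right y).mono ?_
    (Filter.Eventually.of_forall fun ξ => (norm_freqAtom a w x y ξ).le)
  exact (by fun_prop : Continuous fun ξ : ℝ =>
    Complex.exp (2 * Real.pi * Complex.I * x * (ξ + y : ℝ))).aestronglyMeasurable.mul
      ((integrable_freqWindow a w hw).comp_add_right y).1

theorem memLp_freqAtom {N : ℕ} (a w : Fin N → ℂ) (hw : ∀ k, (w k).re ≠ 0) (x y : ℝ) :
    MemLp (freqAtom a w x y) 2 volume := by
  obtain ⟨C, hC⟩ := exists_norm_freqWindow_le a w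
  exact memLp_two_of_integrable_of_bounded (integrable_freqAtom a w hw x y)
    fun ξ => (norm_freqAtom a w x y ξ).trans_le (hC _)

theorem fourier_freqAtom {N : ℕ} (a w : Fin N → ℂ) (hw : ∀ k, (w k).re ≠ 0) (x y t : ℝ) :
    𝓕 (freqAtom a w x y) t = timeFreqShift x y (rationalWindow a w) t := by
  rw [Real.fourier_eq', timeFreqShift, ← integral_fourier_freqWindow a w hw, ← integral_const_mul,
    ← integral_add_right_eq_self (μ := volume) _ (-y)]
  refine integral_congr_ae (Filter.Eventually.of_forall fun ξ => ?_)
  simp only [freqAtom, smul_eq_mul, neg_add_cancel_right, ← mul_assoc, ← Complex.exp_add]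
  congr 2
  simp only [inner]
  push_cast
  simp
  ring

/-- Density means trivial orthogonal complement, and Plancherel moves the inner products to the
frequency side. `H` is the conjugate of an inverse transform, which makes the pairing bilinear; the
phase separating `freqAtom` from the kernel used here is nonzero and drops out. -/
theorem isCompleteSystem_gabor_iff {N : ℕ} (a w : Fin N → ℂ) (hw : ∀ k, (w k).re ≠ 0) (α β : ℝ) :
    IsCompleteSystem (gaborSystem (rationalWindow a w) (memLp_rationalWindow a w hw) α β) ↔
      ∀ H : ℝ → ℂ, MemLp H 2 volume →
        (∀ m n : ℤ, ∫ ξ : ℝ, H ξ * (Complex.exp (2 * Real.pi * Complex.I * (α * m) * ξ) *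
          freqWindow a w (ξ + β * n)) = 0) → H =ᵐ[volume] 0 := by
  have hright : ∀ u : Lp ℂ 2 (volume : Measure ℝ),
      𝓕 (𝓕⁻ u : Lp ℂ 2 (volume : Measure ℝ)) = u :=
    (MeasureTheory.Lp.fourierTransformₗᵢ ℝ ℂ).apply_symm_apply
  have hleft : ∀ u : Lp ℂ 2 (volume : Measure ℝ),
      𝓕⁻ (𝓕 u : Lp ℂ 2 (volume : Measure ℝ)) = u :=
    (MeasureTheory.Lp.fourierTransformₗᵢ ℝ ℂ).symm_apply_apply
  have hF : ∀ m n : ℤ, 𝓕 (memLp_freqAtom a w hw (α * m) (β * n)).toLp =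
      (memLp_timeFreqShift (memLp_rationalWindow a w hw) (α * m) (β * n)).toLp := fun m n =>
    fourier_toLp_eq_of_integrable (integrable_freqAtom a w hw _ _) _ _
      (fourier_freqAtom a w hw _ _)
  have hphase : ∀ (H : ℝ → ℂ) (m n : ℤ), ∫ ξ : ℝ, H ξ * freqAtom a w (α * m) (β * n) ξ =
      Complex.exp (2 * Real.pi * Complex.I * (α * m) * (β * n)) *
      ∫ ξ : ℝ, H ξ * (Complex.exp (2 * Real.pi * Complex.I * (α * m) * ξ) *
          freqWindow a w (ξ + β * n)) := fun H m n => by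
    rw [← integral_const_mul]
    refine integral_congr_ae (Filter.Eventually.of_forall fun ξ => ?_)
    have : Complex.exp (2 * Real.pi * Complex.I * (α * m : ℝ) * (ξ + β * n : ℝ)) =
      Complex.exp (2 * Real.pi * Complex.I * (α * m) * (β * n)) *
        Complex.exp (2 * Real.pi * Complex.I * (α * m) * ξ) := by
      rw [← Complex.exp_add]; congr 1; push_cast; ring
    simp only [freqAtom, this]
    ring
  have horth : ∀ u : Lp ℂ 2 (volume : Measure ℝ),
      u ∈ (Submodule.span ℂ (gaborSystem (rationalWindow a w)
        (memLp_rationalWindow a w hw) α β))ᗮ ↔ ∀ m n : ℤ, ∫ ξ : ℝ,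
        (starRingEnd ℂ) ((𝓕⁻ u : Lp ℂ 2 (volume : Measure ℝ)) ξ) *
          (Complex.exp (2 * Real.pi * Complex.I * (α * m) * ξ) *
          freqWindow a w (ξ + β * n)) = 0 := fun u => by
    rw [Submodule.mem_orthogonal']
    have key : ∀ m n : ℤ, inner ℂ u
        (memLp_timeFreqShift (memLp_rationalWindow a w hw) (α * m) (β * n)).toLp =
        Complex.exp (2 * Real.pi * Complex.I * (α * m) * (β * n)) * ∫ ξ : ℝ,
        (starRingEnd ℂ) ((𝓕⁻ u : Lp ℂ 2 (volume : Measure ℝ)) ξ) *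
          (Complex.exp (2 * Real.pi * Complex.I * (α * m) * ξ) *
          freqWindow a w (ξ + β * n)) := fun m n => by
      rw [← hphase (fun ξ => (starRingEnd ℂ) ((𝓕⁻ u : Lp ℂ 2 (volume : Measure ℝ)) ξ)), ← hF,
        ← hright u, MeasureTheory.Lp.inner_fourier_eq, hright, MeasureTheory.L2.inner_def]
      refine integral_congr_ae ?_
      filter_upwards [(memLp_freqAtom a w hw (α * m) (β * n)).coeFn_toLp] with ξ hξ
      rw [hξ, RCLike.inner_apply, mul_comm]
    constructor
    · intro h m n
      have := h _ (Submodule.subset_span ⟨(m, n), rfl⟩)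
      rw [key] at this
      exact (mul_eq_zero.mp this).resolve_left (Complex.exp_ne_zero _)
    · intro h v hv
      induction hv using Submodule.span_induction with
      | mem v hv =>
        obtain ⟨⟨m, n⟩, rfl⟩ := hv
        exact (key m n).trans (by rw [h m n, mul_zero])
      | zero => simp
      | add v v' _ _ h h' => rw [inner_add_right, h, h', add_zero]
      | smul c v _ h => rw [inner_smul_right, h, mul_zero]
  rw [IsCompleteSystem, Submodule.topologicalClosure_eq_top_iff, Submodule.eq_bot_iff]
  constructor
  · intro h H hH hm
    have h1 := h (𝓕 (hH.star.toLp)) ((horth _).mpr fun m n => by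
      rw [hleft, ← hm m n]
      refine integral_congr_ae ?_
      filter_upwards [hH.star.coeFn_toLp] with ξ hξ
      rw [hξ]; simp)
    have h2 : hH.star.toLp = 0 := by
      rw [← hleft (hH.star.toLp), h1]
      exact map_zero (MeasureTheory.Lp.fourierTransformₗᵢ ℝ ℂ).symm
    have h3 := (MemLp.toLp_eq_toLp_iff hH.star MemLp.zero).mp (h2.trans MemLp.zero.toLp_zero.symm)
    filter_upwards [h3] with ξ hξ
    simpa using hξ
  · intro h u hu
    have h1 := h _ (Lp.memLp (𝓕⁻ u : Lp ℂ 2 (volume : Measure ℝ))).star ((horth u).mp hu)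
    have h2 : (𝓕⁻ u : Lp ℂ 2 (volume : Measure ℝ)) = 0 := by
      rw [Lp.eq_zero_iff_ae_eq_zero]
      filter_upwards [h1] with ξ hξ
      simpa using hξ
    rw [← hright u, h2]
    exact map_zero (MeasureTheory.Lp.fourierTransformₗᵢ ℝ ℂ)

/-! ### Vanishing Fourier coefficients and periodization. -/

/-- This is Parseval on an interval of length `T`. -/
theorem ae_eq_zero_of_fourier_integral_eq_zero {T : ℝ} (hT : 0 < T) {P : ℝ → ℂ}
    (hP : MemLp P 2 (volume.restrict (Set.Ioc 0 T)))
    (h : ∀ m : ℤ, ∫ x in (0 : ℝ)..T, P x * Complex.exp (2 * Real.pi * Complex.I * m * x / T) = 0) :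
    ∀ᵐ x, x ∈ Set.Ioc 0 T → P x = 0 := by
  have hcoeff : ∀ m : ℤ, fourierCoeffOn hT P m = 0 := fun m => by
    rw [fourierCoeffOn_eq_integral]
    have : ∫ x in (0 : ℝ)..T, fourier (-m) (x : AddCircle (T - 0)) • P x = 0 := by
      rw [← h (-m)]
      refine intervalIntegral.integral_congr fun x _ => ?_
      simp only [fourier_coe_apply, smul_eq_mul, sub_zero]
      rw [mul_comm]
    rw [this, smul_zero]
  have hsum := tsum_sq_fourierCoeffOn hT hP
  simp only [hcoeff, norm_zero, ne_eq, OfNat.ofNat_ne_zero, not_false_eq_true, zero_pow,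
    tsum_zero, sub_zero] at hsum
  have h0 : ∫ x in Set.Ioc 0 T, ‖P x‖ ^ 2 = 0 := by
    rw [← intervalIntegral.integral_of_le hT.le]
    exact ((smul_eq_zero.mp hsum.symm).resolve_left (inv_ne_zero hT.ne'))
  rw [integral_eq_zero_iff_of_nonneg (fun x => by positivity)
    ((memLp_two_iff_integrable_sq_norm hP.1).mp hP)] at h0
  have := (ae_restrict_iff' measurableSet_Ioc).mp h0
  filter_upwards [this] with x hx hx'
  simpa using hx hx'

/-- A compactly supported `L²` function all of whose `T⁻¹ ℤ`-frequencies vanish has vanishing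
`T`-periodization. -/
theorem ae_tsum_eq_zero_of_fourier_integral_eq_zero {T : ℝ} (hT : 0 < T) {F : ℝ → ℂ}
    (hF : MemLp F 2 volume) {L : ℕ} (hsupp : ∀ x, F x ≠ 0 → -(L * T) < x ∧ x ≤ L * T)
    (h : ∀ m : ℤ, ∫ x, F x * Complex.exp (2 * Real.pi * Complex.I * m * x / T) = 0) :
    ∀ᵐ x, x ∈ Set.Ioc 0 T → ∑' n : ℤ, F (x + n * T) = 0 := by
  set P : ℝ → ℂ := fun x => ∑ k ∈ Finset.range (2 * L), F (x + ((k : ℝ) - L) * T) with hPdef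
  have hPint : ∀ x ∈ Set.Ioc 0 T, ∑' n : ℤ, F (x + n * T) = P x := fun x hx => by
    -- After the shift by `L`, the half-open support and `x ∈ (0, T]` leave exactly the indices `0 ≤
    -- n < 2 * L`.
    rw [← (Equiv.subRight (L : ℤ)).tsum_eq, tsum_eq_sum (s := (Finset.range (2 * L)).map
      Nat.castEmbedding), Finset.sum_map]
    · simp [hPdef]
    · intro n hn
      by_contra hne
      obtain ⟨h1, h2⟩ := hsupp _ hne
      apply hn
      simp only [Equiv.subRight_apply, Int.cast_sub, Int.cast_natCast] at h1 h2
      have h3 : (-1 : ℝ) < n := by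
        by_contra! hc
        nlinarith [mul_le_mul_of_nonneg_right hc hT.le, hx.2]
      have h4 : (n : ℝ) < 2 * L := by
        by_contra! hc
        nlinarith [mul_le_mul_of_nonneg_right hc hT.le, hx.1]
      have h3' : (-1 : ℤ) < n := by exact_mod_cast h3
      have h4' : n < 2 * L := by exact_mod_cast h4
      simp only [Finset.mem_map, Finset.mem_range, Nat.castEmbedding_apply]
      exact ⟨n.toNat, by omega, by omega⟩
  have hPmem : MemLp P 2 volume := memLp_finsetSum (f := fun (k : ℕ) x => F (x + ((k : ℝ) - L) * T)) _ fun k _ =>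
    hF.comp_measurePreserving (measurePreserving_add_right volume _)
  have hper : ∀ m : ℤ, ∫ x in (0 : ℝ)..T,
      P x * Complex.exp (2 * Real.pi * Complex.I * m * x / T) = 0 := fun m => by
    set E : ℝ → ℂ := fun x => Complex.exp (2 * Real.pi * Complex.I * m * x / T) with hE
    have hEper : ∀ (k : ℕ) x, E (x + ((k : ℝ) - L) * T) = E x := fun k x => by
      have hT' : (T : ℂ) ≠ 0 := by exact_mod_cast hT.ne'
      rw [hE]
      refine Complex.exp_eq_exp_iff_exists_int.mpr ⟨m * ((k : ℤ) - L), ?_⟩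
      push_cast
      field_simp
    have hEb : ∀ x, ‖E x‖ = 1 := fun x => by
      have h2 : (2 * Real.pi * Complex.I * m * x / T : ℂ) =
          ((2 * Real.pi * m * x / T : ℝ) : ℂ) * Complex.I := by push_cast; ring
      rw [hE]; simp only [h2]; exact Complex.norm_exp_ofReal_mul_I _
    have hEc : Continuous E := by fun_prop
    have hloc : ∀ (G : ℝ → ℂ), MemLp G 2 volume → ∀ a b : ℝ,
        IntervalIntegrable (fun x => G x * E x) volume a b := fun G hG a b => by
      have : LocallyIntegrable G volume := hG.locallyIntegrable (by norm_num)
      exact (this.integrableOn_isCompact isCompact_uIcc).intervalIntegrable.mul_continuousOn hEc.continuousOn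
    calc ∫ x in (0 : ℝ)..T, P x * E x
        = ∫ x in (0 : ℝ)..T, ∑ k ∈ Finset.range (2 * L), F (x + ((k : ℝ) - L) * T) * E x := by
          simp only [hPdef, Finset.sum_mul]
      _ = ∑ k ∈ Finset.range (2 * L), ∫ x in (0 : ℝ)..T, F (x + ((k : ℝ) - L) * T) * E x :=
          intervalIntegral.integral_finsetSum fun k _ => hloc _
            (hF.comp_measurePreserving (measurePreserving_add_right volume _)) _ _
      _ = ∑ k ∈ Finset.range (2 * L),
            ∫ x in (((k : ℕ) : ℝ) - L) * T..(((k + 1 : ℕ) : ℝ) - L) * T, F x * E x := by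
          refine Finset.sum_congr rfl fun k _ => ?_
          have := intervalIntegral.integral_comp_add_right (a := 0) (b := T)
            (fun x => F x * E x) (((k : ℝ) - L) * T)
          simp only [hEper] at this
          rw [this]
          congr 1 <;> push_cast <;> ring
      _ = ∫ x in (((0 : ℕ) : ℝ) - L) * T..(((2 * L : ℕ) : ℝ) - L) * T, F x * E x :=
          intervalIntegral.sum_integral_adjacent_intervals
            (a := fun k : ℕ => ((k : ℝ) - L) * T) fun k _ => hloc F hF _ _
      _ = ∫ x, F x * E x := by
          refine intervalIntegral.integral_eq_integral_of_support_subset fun x hx => ?_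
          have := hsupp x (left_ne_zero_of_mul hx)
          constructor <;> push_cast <;> nlinarith [this.1, this.2]
      _ = 0 := h m
  filter_upwards [ae_eq_zero_of_fourier_integral_eq_zero hT (hPmem.restrict _) hper] with x hx hx'
  rw [hPint x hx', hx hx']

/-! ### Polynomials in the shift and linear recurrences. -/

/-- Forward shift on two-sided sequences. -/
def seqShift : Module.End ℂ (ℤ → ℂ) where
  toFun z i := z (i + 1)
  map_add' _ _ := rfl
  map_smul' _ _ := rfl

/-- Backward shift on two-sided sequences. -/
def seqShiftBack : Module.End ℂ (ℤ → ℂ) where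
  toFun z i := z (i - 1)
  map_add' _ _ := rfl
  map_smul' _ _ := rfl

/-- Coefficients of a polynomial, extended by zero to negative indices. -/
def intCoeff (p : Polynomial ℂ) (d : ℤ) : ℂ := if 0 ≤ d then p.coeff d.toNat else 0

open Polynomial

theorem seqShift_pow_apply (r : ℕ) (z : ℤ → ℂ) (i : ℤ) : (seqShift ^ r) z i = z (i + r) := by
  induction r generalizing i with
  | zero => simp
  | succ r ih =>
    rw [pow_succ', Module.End.mul_apply]
    change (seqShift ^ r) z (i + 1) = _
    rw [ih]; congr 1; push_cast; ring

theorem seqShiftBack_pow_apply (r : ℕ) (z : ℤ → ℂ) (i : ℤ) :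
    (seqShiftBack ^ r) z i = z (i - r) := by
  induction r generalizing i with
  | zero => simp
  | succ r ih =>
    rw [pow_succ', Module.End.mul_apply]
    change (seqShiftBack ^ r) z (i - 1) = _
    rw [ih]; congr 1; push_cast; ring

theorem aeval_seqShift_apply (p : ℂ[X]) {n : ℕ} (hn : p.natDegree < n) (z : ℤ → ℂ) (i : ℤ) :
    aeval seqShift p z i = ∑ r ∈ Finset.range n, p.coeff r * z (i + r) := by
  rw [aeval_eq_sum_range' hn, LinearMap.sum_apply, Finset.sum_apply]
  exact Finset.sum_congr rfl fun r _ => by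
    rw [LinearMap.smul_apply, Pi.smul_apply, seqShift_pow_apply, smul_eq_mul]

theorem aeval_seqShiftBack_apply (p : ℂ[X]) {n : ℕ} (hn : p.natDegree < n) (z : ℤ → ℂ) (i : ℤ) :
    aeval seqShiftBack p z i = ∑ r ∈ Finset.range n, p.coeff r * z (i - r) := by
  rw [aeval_eq_sum_range' hn, LinearMap.sum_apply, Finset.sum_apply]
  exact Finset.sum_congr rfl fun r _ => by
    rw [LinearMap.smul_apply, Pi.smul_apply, seqShiftBack_pow_apply, smul_eq_mul]

theorem intCoeff_natCast (p : ℂ[X]) (r : ℕ) : intCoeff p r = p.coeff r := by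
  simp [intCoeff]

theorem intCoeff_eq_zero {p : ℂ[X]} {d : ℤ} (h : d < 0 ∨ (p.natDegree : ℤ) < d) :
    intCoeff p d = 0 := by
  unfold intCoeff
  split_ifs with h0
  · exact coeff_eq_zero_of_natDegree_lt (by omega)
  · rfl

theorem aeval_seqShiftBack_single (p : ℂ[X]) (d : ℤ) :
    aeval seqShiftBack p (Pi.single 0 1) d = intCoeff p d := by
  rw [aeval_seqShiftBack_apply p (Nat.lt_succ_self _)]
  by_cases h : 0 ≤ d
  · lift d to ℕ using h
    rw [intCoeff_natCast]
    simp only [Pi.single_apply, sub_eq_zero, Nat.cast_inj, mul_ite, mul_one, mul_zero]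
    rw [Finset.sum_ite_eq]
    split_ifs with h
    · rfl
    · rw [coeff_eq_zero_of_natDegree_lt]; simpa using h
  · rw [intCoeff_eq_zero (by omega)]
    refine Finset.sum_eq_zero fun r _ => ?_
    rw [Pi.single_eq_of_ne (by omega), mul_zero]

/-- Summation against `intCoeff` is the action of the polynomial in the shift. -/
theorem tsum_mul_intCoeff (p : ℂ[X]) (z : ℤ → ℂ) (i : ℤ) :
    ∑' n : ℤ, z n * intCoeff p (n - i) = aeval seqShift p z i := by
  rw [aeval_seqShift_apply p (Nat.lt_succ_self _), ← (Equiv.addRight i).tsum_eq,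
    tsum_eq_sum (s := (Finset.range (p.natDegree + 1)).map Nat.castEmbedding), Finset.sum_map]
  · refine Finset.sum_congr rfl fun r _ => ?_
    simp [intCoeff_natCast, mul_comm, add_comm]
  · intro d hd
    rw [intCoeff_eq_zero, mul_zero]
    by_contra! hc
    apply hd
    simp only [Equiv.coe_addRight, add_sub_cancel_right] at hc
    simp only [Finset.mem_map, Finset.mem_range, Nat.castEmbedding_apply]
    exact ⟨d.toNat, by omega, by omega⟩

/-- The polynomial `∏ (1 - q_l X)`. -/
def geomPoly {ι : Type*} (s : Finset ι) (q : ι → ℂ) : ℂ[X] := ∏ l ∈ s, (1 - C (q l) * X)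

theorem natDegree_geomPoly_le {ι : Type*} (s : Finset ι) (q : ι → ℂ) :
    (geomPoly s q).natDegree ≤ s.card := by
  refine (natDegree_prod_le _ _).trans ?_
  rw [Finset.card_eq_sum_ones]
  refine Finset.sum_le_sum fun l _ => ?_
  refine (natDegree_sub_le _ _).trans ?_
  simpa using natDegree_C_mul_le (q l) X

/-- This separates the products that omit one factor: at `(q k)⁻¹` only the product omitting the
factor `k` survives. -/
theorem geomPoly_eval_inv {ι : Type*} (s : Finset ι) (q : ι → ℂ) (hq : ∀ l, q l ≠ 0)
    (hinj : Function.Injective q) (k : ι) :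
    (geomPoly s q).eval (q k)⁻¹ = 0 ↔ k ∈ s := by
  rw [geomPoly, eval_prod, Finset.prod_eq_zero_iff]
  simp only [eval_sub, eval_one, eval_mul, eval_C, eval_X]
  constructor
  · rintro ⟨l, hl, h⟩
    have : q l = q k := by
      have := hq k
      field_simp at h
      linear_combination -h
    rwa [← hinj this]
  · intro h
    exact ⟨k, h, by rw [mul_inv_cancel₀ (hq k), sub_self]⟩

/-- A sequence killed by `∏ (1 - q_l S)` on an interval is a combination of the geometric sequences
`q_l⁻ⁱ` there. -/
theorem exists_eq_sum_of_aeval_geomPoly_eq_zero {ι : Type*} [DecidableEq ι] (s : Finset ι) (q : ι → ℂ)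
    (hq : ∀ l, q l ≠ 0) (hinj : Function.Injective q) (z : ℤ → ℂ) (a b : ℤ)
    (h : ∀ i, a < i → i + s.card < b → aeval seqShift (geomPoly s q) z i = 0) :
    ∃ c : ι → ℂ, ∀ i, a < i → i < b → z i = ∑ l ∈ s, c l * (q l)⁻¹ ^ i := by
  induction s using Finset.induction_on generalizing z b with
  | empty => exact ⟨0, fun i h1 h2 => by simpa [geomPoly] using h i h1 (by simpa using h2)⟩
  | insert k s hk ih =>
    set u : ℤ → ℂ := fun i => z i - q k * z (i + 1) with hu
    have haev : aeval seqShift (1 - C (q k) * X) z = u := by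
      ext i
      simp [hu, seqShift]
    -- Since `u i` involves `z (i + 1)`, the interval loses one point, matching the removed factor.
    obtain ⟨c, hc⟩ := ih u (b - 1) fun i h1 h2 => by
      rw [← haev, ← Module.End.mul_apply, ← map_mul, mul_comm, geomPoly,
        ← Finset.prod_insert (f := fun l => 1 - C (q l) * X) hk]
      exact h i h1 (by rw [Finset.card_insert_of_notMem hk]; push_cast; omega)
    -- On the sequence `(q l)⁻¹ ^ i` the factor `1 - q k S` acts as multiplication by `1 - q k / q
    -- l`, nonzero for `l ≠ k`. Dividing by it gives a particular solution; the remainder `v`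
    -- satisfies a first-order recurrence.
    set c' : ι → ℂ := fun l => c l / (1 - q k * (q l)⁻¹) with hc'
    set v : ℤ → ℂ := fun i => z i - ∑ l ∈ s, c' l * (q l)⁻¹ ^ i with hv
    have hstep : ∀ i, a < i → i < b - 1 → v (i + 1) = (q k)⁻¹ * v i := fun i h1 h2 => by
      have h3 : u i = ∑ l ∈ s, (c' l * (q l)⁻¹ ^ i - q k * (c' l * (q l)⁻¹ ^ (i + 1))) := by
        rw [hc i h1 h2]
        refine Finset.sum_congr rfl fun l hl => ?_
        have hne : 1 - q k * (q l)⁻¹ ≠ 0 := by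
          intro h0
          have hl0 := hq l
          field_simp at h0
          exact hk (hinj (show q l = q k by linear_combination h0) ▸ hl)
        rw [zpow_add₀ (inv_ne_zero (hq l)), zpow_one]
        have : c l = c' l * (1 - q k * (q l)⁻¹) := by rw [hc', div_mul_cancel₀ _ hne]
        rw [this]; ring
      rw [Finset.sum_sub_distrib, ← Finset.mul_sum] at h3
      have h4 : v i = q k * v (i + 1) := by
        simp only [hv, hu] at h3 ⊢
        linear_combination h3
      rw [h4, inv_mul_cancel_left₀ (hq k)]
    have hv' : ∀ n : ℕ, a + 1 + n < b → v (a + 1 + n) = (q k)⁻¹ ^ n * v (a + 1) := fun n => by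
      induction n with
      | zero => simp
      | succ n ihn =>
        intro hn
        push_cast at hn ⊢
        rw [← add_assoc, hstep _ (by omega) (by omega), ihn (by omega), pow_succ']
        ring
    refine ⟨fun l => if l = k then v (a + 1) * (q k)⁻¹ ^ (-(a + 1)) else c' l, fun i h1 h2 => ?_⟩
    simp only
    rw [Finset.sum_insert hk, if_pos rfl]
    have h5 : ∑ l ∈ s, (if l = k then v (a + 1) * (q k)⁻¹ ^ (-(a + 1)) else c' l) * (q l)⁻¹ ^ i =
        ∑ l ∈ s, c' l * (q l)⁻¹ ^ i :=
      Finset.sum_congr rfl fun l hl => by rw [if_neg (ne_of_mem_of_not_mem hl hk)]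
    rw [h5]
    obtain ⟨n, hn⟩ := Int.eq_ofNat_of_zero_le (show 0 ≤ i - (a + 1) by omega)
    have h6 := hv' n (by omega)
    have h7 : a + 1 + n = i := by omega
    rw [h7] at h6
    rw [mul_assoc, ← zpow_add₀ (inv_ne_zero (hq k)), show -(a + 1) + i = n by omega, zpow_natCast,
      mul_comm (v (a + 1)), ← h6]
    simp [hv]

/-- If a nonzero polynomial in the shift kills a sequence tending to zero at both ends, the
sequence vanishes. -/
theorem eq_zero_of_aeval_seqShift_eq_zero {p : ℂ[X]} (hp : p ≠ 0) {z : ℤ → ℂ}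
    (hz : Filter.Tendsto z Filter.cofinite (nhds 0)) (h : aeval seqShift p z = 0) : z = 0 := by
  have hfac := (IsAlgClosed.splits p).eq_prod_roots
  have hlead : p.leadingCoeff ≠ 0 := leadingCoeff_ne_zero.mpr hp
  have h1 : aeval seqShift (p.roots.map fun r => X - C r).prod z = 0 := by
    rw [hfac, map_mul, Module.End.mul_apply, aeval_C] at h
    ext i
    have := congrFun h i
    simpa [Module.algebraMap_end_apply, hlead] using this
  clear h hfac
  generalize p.roots = m at h1
  -- The roots are peeled off one at a time; each leaves a purely geometric sequence.
  induction m using Multiset.induction_on generalizing z with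
  | empty => simpa using h1
  | cons r m ih =>
    rw [Multiset.map_cons, Multiset.prod_cons, mul_comm, map_mul, Module.End.mul_apply] at h1
    have hu : aeval seqShift (X - C r) z = fun i => z (i + 1) - r * z i := by
      ext i; simp [seqShift]
    have hsucc : Filter.Tendsto (fun i : ℤ => i + 1) Filter.cofinite Filter.cofinite :=
      (add_left_injective 1).tendsto_cofinite
    have hrec := ih (z := aeval seqShift (X - C r) z) (by
      rw [hu]
      simpa using (hz.comp hsucc).sub (hz.const_mul r)) h1
    rw [hu] at hrec
    have hstep : ∀ i, z (i + 1) = r * z i := fun i => sub_eq_zero.mp (congrFun hrec i)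
    by_contra hne
    obtain ⟨i, hi⟩ : ∃ i, z i ≠ 0 := by
      by_contra! hc
      exact hne (funext hc)
    have hplus : Filter.Tendsto (fun n : ℕ => z (i + n)) Filter.atTop (nhds 0) := by
      rw [← Nat.cofinite_eq_atTop]
      exact hz.comp (Function.Injective.tendsto_cofinite fun a b hab => by simpa using hab)
    have hminus : Filter.Tendsto (fun n : ℕ => z (i - n)) Filter.atTop (nhds 0) := by
      rw [← Nat.cofinite_eq_atTop]
      exact hz.comp (Function.Injective.tendsto_cofinite fun a b hab => by simpa using hab)
    have hn : ∀ n : ℕ, z (i + n) = r ^ n * z i := fun n => by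
      induction n with
      | zero => simp
      | succ n ihn => push_cast; rw [← add_assoc, hstep, ihn, pow_succ']; ring
    have hm : ∀ n : ℕ, z i = r ^ n * z (i - n) := fun n => by
      induction n with
      | zero => simp
      | succ n ihn =>
        have := hstep (i - (n + 1))
        rw [show i - ((n : ℤ) + 1) + 1 = i - n by ring] at this
        rw [ihn, this]; push_cast; ring
    have hpos : 0 < ‖z i‖ := norm_pos_iff.mpr hi
    -- A nonzero geometric sequence fails to decay forwards if `1 ≤ ‖r‖` and backwards if `‖r‖ ≤ 1`.
    rcases le_total 1 ‖r‖ with hr | hr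
    · have := ge_of_tendsto hplus.norm (Filter.Eventually.of_forall fun n => by
        rw [hn, norm_mul, norm_pow]
        exact le_mul_of_one_le_left hpos.le (one_le_pow₀ hr))
      simp at this
      exact hi this
    · have := ge_of_tendsto (b := ‖z i‖) hminus.norm (Filter.Eventually.of_forall fun n => by
        have := congrArg norm (hm n)
        rw [norm_mul, norm_pow] at this
        rw [this]
        exact mul_le_of_le_one_left (norm_nonneg _) (pow_le_one₀ (norm_nonneg _) hr))
      simp at this
      exact hi this

open Polynomial Filter Topology

/-! ### Geometric sequences vanishing on the gaps of a pattern. -/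

/-- Geometric sequences with ratios of distinct moduli are linearly independent on every set of
naturals that is not bounded above. -/
theorem eq_zero_of_frequently_sum_pow_eq_zero {ι : Type*} [Fintype ι] {p : ι → ℂ}
    (hp : ∀ l, p l ≠ 0) (hinj : Function.Injective fun l => ‖p l‖) {c : ι → ℂ}
    (h : ∃ᶠ n : ℕ in atTop, ∑ l, c l * p l ^ n = 0) : c = 0 := by
  classical
  by_contra hc
  obtain ⟨l₁, hl₁⟩ := Function.ne_iff.mp hc
  -- After division by the `n`-th power of the dominant ratio, only its coefficient survives in the
  -- limit.
  obtain ⟨l₀, hl₀, hmax⟩ := Finset.exists_max_image (Finset.univ.filter fun l => c l ≠ 0)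
    (fun l => ‖p l‖) ⟨l₁, by simpa using hl₁⟩
  have hlim : Tendsto (fun n : ℕ => ∑ l, c l * (p l / p l₀) ^ n) atTop
      (𝓝 (∑ l, if l = l₀ then c l₀ else 0)) := by
    refine tendsto_finsetSum _ fun l _ => ?_
    by_cases hl : l = l₀
    · subst hl
      simp [div_self (hp l)]
    · rw [if_neg hl]
      by_cases hcl : c l = 0
      · simp [hcl]
      · have hlt : ‖p l‖ < ‖p l₀‖ :=
          lt_of_le_of_ne (hmax l (by simpa using hcl)) fun he => hl (hinj he)
        rw [← mul_zero (c l)]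
        refine (tendsto_pow_atTop_nhds_zero_of_norm_lt_one ?_).const_mul _
        rw [norm_div, div_lt_one (norm_pos_iff.mpr (hp l₀))]
        exact hlt
  have hfreq : ∃ᶠ n : ℕ in atTop, ∑ l, c l * (p l / p l₀) ^ n = 0 := h.mono fun n hn => by
    simp_rw [div_pow, ← mul_div_assoc]
    rw [← Finset.sum_div, hn, zero_div]
  simp only [Finset.sum_ite_eq', Finset.mem_univ, if_true] at hlim
  have hmem : c l₀ ∈ ({0} : Set ℂ) := isClosed_singleton.mem_of_frequently_of_tendsto hfreq hlim
  exact (Finset.mem_filter.mp hl₀).2 hmem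

/-- A finite subset of an unbounded set of naturals already suffices for the independence of
geometric sequences. -/
theorem exists_bound_eq_zero_of_sum_pow_eq_zero {ι : Type*} [Fintype ι] {p : ι → ℂ}
    (hp : ∀ l, p l ≠ 0) (hinj : Function.Injective fun l => ‖p l‖) {G : Set ℕ}
    (hG : ∃ᶠ n : ℕ in atTop, n ∈ G) :
    ∃ T : ℕ, ∀ c : ι → ℂ, (∀ n ≤ T, n ∈ G → ∑ l, c l * p l ^ n = 0) → c = 0 := by
  -- The solution spaces of the conditions up to `T` decrease with `T` in a finite-dimensional
  -- space, so they stabilize.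
  let W : ℕ →o (Submodule ℂ (ι → ℂ))ᵒᵈ :=
    { toFun := fun T => OrderDual.toDual
        { carrier := {c | ∀ n ≤ T, n ∈ G → ∑ l, c l * p l ^ n = 0}
          add_mem' := fun {c c'} h h' n hn hnG => by
            simp [add_mul, Finset.sum_add_distrib, h n hn hnG, h' n hn hnG]
          zero_mem' := fun n _ _ => by simp
          smul_mem' := fun r c h n hn hnG => by
            simp [mul_assoc, ← Finset.mul_sum, h n hn hnG] }
      monotone' := fun T T' hT c hc n hn hnG => hc n (hn.trans hT) hnG }
  obtain ⟨T, hT⟩ := IsArtinian.monotone_stabilizes W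
  refine ⟨T, fun c hc => eq_zero_of_frequently_sum_pow_eq_zero hp hinj (hG.mono fun n hn => ?_)⟩
  have h1 : c ∈ OrderDual.ofDual (W T) := hc
  rw [hT (max T n) (le_max_left _ _)] at h1
  exact h1 n (le_max_right _ _) hn

theorem aeval_seqShift_single (p : ℂ[X]) (e i : ℤ) :
    aeval seqShift p (Pi.single e 1) i = intCoeff p (e - i) := by
  rw [← tsum_mul_intCoeff, tsum_eq_single e fun n hn => by rw [Pi.single_eq_of_ne hn, zero_mul]]
  simp

theorem add_le_of_strictMono_int {d : ℤ → ℤ} (hd : StrictMono d) (i : ℤ) (n : ℕ) :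
    d i + n ≤ d (i + n) := by
  induction n with
  | zero => simp
  | succ n ih =>
    have := hd (show i + (n : ℤ) < i + ((n + 1 : ℕ) : ℤ) by push_cast; omega)
    push_cast at this ⊢
    omega

/-- Placing `v n` at position `d n` gives a sequence killed by `geomPoly s q`, hence a combination
of geometric sequences on the window. It vanishes at every index missed by `d`, and finitely many
such gaps already force all coefficients to be zero. -/
theorem exists_window_eq_zero_of_sum_intCoeff_eq_zero {ι : Type*} [DecidableEq ι]
    (s : Finset ι) {q : ι → ℂ} (hq : ∀ l, q l ≠ 0) (hinj : Function.Injective fun l => ‖q l‖)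
    {d : ℤ → ℤ} (hd : StrictMono d) (hgap : ∃ᶠ n : ℕ in atTop, ∀ j, d j ≠ n) :
    ∃ K₀ : ℕ, ∀ K : ℕ, K₀ ≤ K → ∀ v : ℤ → ℂ,
      (∀ i, d (-K - 1) < i → i + s.card < d (K + 1) →
        ∑ n ∈ Finset.Icc (-K : ℤ) K, v n * intCoeff (geomPoly s q) (d n - i) = 0) →
      ∀ n ∈ Finset.Icc (-K : ℤ) K, v n = 0 := by
  obtain ⟨T, hT⟩ := exists_bound_eq_zero_of_sum_pow_eq_zero (ι := s) (p := fun l => (q l)⁻¹)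
    (fun l => inv_ne_zero (hq l)) (fun l l' h => Subtype.ext (hinj (by simpa using h)))
    (G := {n : ℕ | ∀ j, d j ≠ n}) hgap
  -- A strictly increasing `d` moves by at least one per step, so for such `K` the window contains
  -- `0, …, T`.
  refine ⟨(d 0).natAbs + T, fun K hK v hv => ?_⟩
  have hleft : d (-K - 1) < 0 := by
    have := add_le_of_strictMono_int hd (-K - 1) (K + 1)
    rw [show (-K - 1 : ℤ) + ((K + 1 : ℕ) : ℤ) = 0 by push_cast; ring] at this
    push_cast at this
    omega
  have hright : (T : ℤ) < d (K + 1) := by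
    have := add_le_of_strictMono_int hd 0 (K + 1)
    rw [show (0 : ℤ) + ((K + 1 : ℕ) : ℤ) = K + 1 by push_cast; ring] at this
    push_cast at this
    omega
  set z : ℤ → ℂ := ∑ n ∈ Finset.Icc (-K : ℤ) K, v n • Pi.single (d n) 1 with hz
  have hzd : ∀ n ∈ Finset.Icc (-K : ℤ) K, z (d n) = v n := fun n hn => by
    rw [hz, Finset.sum_apply, Finset.sum_eq_single_of_mem n hn]
    · simp
    · intro m _ hm
      rw [Pi.smul_apply, Pi.single_eq_of_ne fun h => hm (hd.injective h).symm, smul_zero]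
  have hz0 : ∀ i, (∀ j, d j ≠ i) → z i = 0 := fun i hi => by
    rw [hz, Finset.sum_apply]
    refine Finset.sum_eq_zero fun n _ => ?_
    rw [Pi.smul_apply, Pi.single_eq_of_ne fun h => hi n h.symm, smul_zero]
  obtain ⟨c, hc⟩ := exists_eq_sum_of_aeval_geomPoly_eq_zero s q hq
    (fun l l' h => hinj (congrArg norm h)) z (d (-K - 1)) (d (K + 1)) fun i h1 h2 => by
      rw [← hv i h1 h2, hz, map_sum, Finset.sum_apply]
      refine Finset.sum_congr rfl fun n _ => ?_
      rw [map_smul, Pi.smul_apply, aeval_seqShift_single, smul_eq_mul]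
  have hc0 : (fun l : s => c l) = 0 := hT _ fun n hn hnG => by
    rw [Finset.sum_coe_sort s fun l => c l * (q l)⁻¹ ^ n]
    have := hc n (by omega) (by omega)
    rw [hz0 n hnG] at this
    simpa using this.symm
  intro n hn
  have hn' := Finset.mem_Icc.mp hn
  rw [← hzd n hn, hc (d n) (hd (by omega)) (hd (by omega))]
  exact Finset.sum_eq_zero fun l hl => by rw [show c l = 0 from congrFun hc0 ⟨l, hl⟩, zero_mul]

/-! ### Analytic families of matrices. -/

theorem ae_ne_zero_of_analytic {f : ℝ → ℂ} (hf : AnalyticOnNhd ℝ f Set.univ) {x₀ : ℝ}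
    (hx₀ : f x₀ ≠ 0) : ∀ᵐ x, f x ≠ 0 := by
  have h1 := hf.preimage_zero_mem_codiscrete hx₀
  have h2 := ae_restrict_le_codiscreteWithin (μ := (volume : Measure ℝ)) MeasurableSet.univ h1
  rw [Measure.restrict_univ] at h2
  filter_upwards [h2] with x hx
  exact hx

open scoped ComplexOrder in
/-- An analytic family of matrices whose limit at infinity is injective is injective almost
everywhere. -/
theorem ae_mulVec_injective_of_tendsto {R S : Type*} [Fintype R] [Fintype S] [DecidableEq S]
    {E : ℝ → Matrix R S ℂ} (hE : ∀ i j, AnalyticOnNhd ℝ (fun x => E x i j) Set.univ)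
    {E₀ : Matrix R S ℂ} (hlim : ∀ i j, Tendsto (fun x => E x i j) atTop (𝓝 (E₀ i j)))
    (h₀ : ∀ v, E₀.mulVec v = 0 → v = 0) : ∀ᵐ x, ∀ v, (E x).mulVec v = 0 → v = 0 := by
  -- The matrices need not be square; multiplying by the adjoint of the limit yields an analytic
  -- determinant whose limit is a nonzero Gram determinant.
  have hdet₀ : (E₀.conjTranspose * E₀).det ≠ 0 := fun hd => by
    obtain ⟨v, hv, hv0⟩ := Matrix.exists_mulVec_eq_zero_iff.mpr hd
    exact hv (h₀ v (Matrix.conjTranspose_mul_self_mulVec_eq_zero E₀ v |>.mp hv0))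
  have hana : AnalyticOnNhd ℝ (fun x => (E₀.conjTranspose * E x).det) Set.univ := by
    simp only [Matrix.det_apply, Matrix.mul_apply]
    refine Finset.analyticOnNhd_fun_sum _ fun σ _ => ?_
    refine AnalyticOnNhd.const_smul ?_
    refine Finset.analyticOnNhd_fun_prod _ fun j _ => ?_
    exact Finset.analyticOnNhd_fun_sum _ fun i _ => analyticOnNhd_const.mul (hE _ _)
  have hlim' : Tendsto (fun x => (E₀.conjTranspose * E x).det) atTop
      (𝓝 (E₀.conjTranspose * E₀).det) := by
    simp only [Matrix.det_apply, Matrix.mul_apply]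
    refine tendsto_finsetSum _ fun σ _ => Tendsto.const_smul ?_ _
    exact tendsto_finsetProd _ fun j _ => tendsto_finsetSum _ fun i _ => (hlim _ _).const_mul _
  obtain ⟨x₀, hx₀⟩ := (hlim'.eventually_ne hdet₀).exists
  filter_upwards [ae_ne_zero_of_analytic hana hx₀] with x hx v hv
  by_contra hne
  exact hx (Matrix.exists_mulVec_eq_zero_iff.mp ⟨v, hne, by
    rw [← Matrix.mulVec_mulVec, hv, Matrix.mulVec_zero]⟩)

/-! ### The compactly supported window and its values on cells. -/

/-- The ratio by which `halfLineExp w` decays over a distance `β`. -/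
def decayRatio (β : ℝ) (w : ℂ) : ℂ := Complex.exp (-(2 * Real.pi * w) * β)

theorem decayRatio_ne_zero (β : ℝ) (w : ℂ) : decayRatio β w ≠ 0 := Complex.exp_ne_zero _

theorem decayRatio_norm_injective {N : ℕ} {w : Fin N → ℂ}
    (hdist : ∀ k l, k ≠ l → (w k).re ≠ (w l).re) {β : ℝ} (hβ : 0 < β) :
    Function.Injective fun k => ‖decayRatio β (w k)‖ := by
  intro k l h
  by_contra hne
  apply hdist k l hne
  simp only [decayRatio, Complex.norm_exp] at h
  have := Real.exp_injective h
  simp at this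
  rcases this with h | h
  · exact h
  · exact absurd h hβ.ne'

/-- A finite combination of `β`-translates of `freqWindow` with compact support. -/
def compactWindow {N : ℕ} (a w : Fin N → ℂ) (β : ℝ) (ξ : ℝ) : ℂ :=
  ∑ r ∈ Finset.range (N + 1), (geomPoly Finset.univ fun k => decayRatio β (w k)).coeff r *
    freqWindow a w (ξ - β * r)

/-- Cells are open on the left and closed on the right because `halfLineExp` switches strictly after
0; thus the switch depends on the cell alone. -/
theorem halfLineExp_add (w : ℂ) {β u : ℝ} (hu : 0 < u) (huβ : u ≤ β) (e : ℤ) :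
    halfLineExp w (β * e + u) = Complex.exp (-(2 * Real.pi * w) * u) *
      (decayRatio β w ^ e * ((if 0 ≤ e then 1 else 0) - (if 0 < w.re then 0 else 1))) := by
  have hiff : 0 < β * e + u ↔ 0 ≤ e := by
    constructor
    · intro h
      by_contra! hc
      have : (e : ℝ) ≤ -1 := by exact_mod_cast Int.le_sub_one_of_lt hc
      nlinarith
    · intro h
      have : (0 : ℝ) ≤ e := by exact_mod_cast h
      have hβ : 0 < β := hu.trans_le huβ
      positivity
  have hexp : Complex.exp (-(2 * Real.pi * w) * (β * e + u : ℝ)) =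
      Complex.exp (-(2 * Real.pi * w) * u) * decayRatio β w ^ e := by
    rw [decayRatio, ← Complex.exp_int_mul, ← Complex.exp_add]
    congr 1
    push_cast
    ring
  rw [halfLineExp, hexp]
  simp only [hiff]
  ring

/-- Only the unit jump at 0 survives, whatever the constant `κ`. Both signs of `w.re` are therefore
handled at once. -/
theorem aeval_seqShiftBack_geometric {q : ℂ} (hq : q ≠ 0) (κ : ℂ) :
    aeval seqShiftBack (1 - C q * X)
      (fun e : ℤ => q ^ e * ((if 0 ≤ e then 1 else 0) - κ)) = Pi.single 0 1 := by
  ext e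
  have h : aeval seqShiftBack (1 - C q * X)
      (fun e : ℤ => q ^ e * ((if 0 ≤ e then 1 else 0) - κ)) e =
      q ^ e * ((if 0 ≤ e then 1 else 0) - κ) -
        q * (q ^ (e - 1) * ((if 0 ≤ e - 1 then 1 else 0) - κ)) := by
    simp [seqShiftBack]
  rw [h, ← mul_assoc, ← zpow_one_add₀ hq, add_sub_cancel]
  rcases lt_trichotomy e 0 with he | rfl | he
  · rw [Pi.single_eq_of_ne he.ne, if_neg (by omega), if_neg (by omega)]; ring
  · simp
  · rw [Pi.single_eq_of_ne he.ne', if_pos (by omega), if_pos (by omega)]; ring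

/-- The factor belonging to `k` collapses the `k`-th exponential to a unit impulse; the other
factors spread this impulse with their coefficients. -/
theorem compactWindow_add {N : ℕ} (a w : Fin N → ℂ) {β u : ℝ} (hu : 0 < u) (huβ : u ≤ β) (d : ℤ) :
    compactWindow a w β (β * d + u) = ∑ k, 2 * Real.pi * Complex.I * a k *
      Complex.exp (-(2 * Real.pi * w k) * u) *
      intCoeff (geomPoly (Finset.univ.erase k) fun k => decayRatio β (w k)) d := by
  set q : Fin N → ℂ := fun k => decayRatio β (w k) with hq
  have hdeg : (geomPoly Finset.univ q).natDegree < N + 1 :=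
    Nat.lt_succ_of_le ((natDegree_geomPoly_le _ _).trans (by simp))
  simp only [compactWindow, freqWindow, Finset.mul_sum]
  rw [Finset.sum_comm]
  refine Finset.sum_congr rfl fun k _ => ?_
  have h1 : geomPoly Finset.univ q = geomPoly (Finset.univ.erase k) q * (1 - C (q k) * X) :=
    (Finset.prod_erase_mul _ _ (Finset.mem_univ k)).symm
  rw [← aeval_seqShiftBack_single, ← aeval_seqShiftBack_geometric (decayRatio_ne_zero β (w k))
    (if 0 < (w k).re then 0 else 1), ← Module.End.mul_apply, ← map_mul, ← h1,
    aeval_seqShiftBack_apply _ hdeg, Finset.mul_sum]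
  refine Finset.sum_congr rfl fun r _ => ?_
  have h2 : β * d + u - β * r = β * ((d - r : ℤ) : ℝ) + u := by push_cast; ring
  rw [h2, halfLineExp_add (w k) hu huβ]
  ring

/-- The index of the cell `(β d, β (d + 1)]` containing a given point. -/
def cellIndex (β ξ : ℝ) : ℤ := ⌈ξ / β⌉ - 1

theorem cellIndex_offset_pos {β : ℝ} (hβ : 0 < β) (ξ : ℝ) : 0 < ξ - β * cellIndex β ξ := by
  have h := Int.ceil_lt_add_one (ξ / β)
  have h2 : (cellIndex β ξ : ℝ) < ξ / β := by rw [cellIndex]; push_cast; linarith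
  rw [lt_div_iff₀ hβ] at h2
  linarith

theorem cellIndex_offset_le {β : ℝ} (hβ : 0 < β) (ξ : ℝ) : ξ - β * cellIndex β ξ ≤ β := by
  have h := Int.le_ceil (ξ / β)
  have h2 : ξ / β ≤ cellIndex β ξ + 1 := by rw [cellIndex]; push_cast; linarith
  rw [div_le_iff₀ hβ] at h2
  linarith

theorem compactWindow_eq {N : ℕ} (a w : Fin N → ℂ) {β : ℝ} (hβ : 0 < β) (ξ : ℝ) (j : ℤ) :
    compactWindow a w β (ξ - β * j) = ∑ k, 2 * Real.pi * Complex.I * a k *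
      Complex.exp (-(2 * Real.pi * w k) * (ξ - β * cellIndex β ξ : ℝ)) *
      intCoeff (geomPoly (Finset.univ.erase k) fun k => decayRatio β (w k))
        (cellIndex β ξ - j) := by
  rw [← compactWindow_add a w (cellIndex_offset_pos hβ ξ) (cellIndex_offset_le hβ ξ)]
  congr 1
  push_cast
  ring

/-- The polynomials with one factor omitted have degree at most `N - 1`, so only the cells `0, …, N
- 1` contribute. -/
theorem compactWindow_eq_zero {N : ℕ} (a w : Fin N → ℂ) {β : ℝ} (hβ : 0 < β) {ξ : ℝ}
    (h : ξ ≤ 0 ∨ β * N < ξ) : compactWindow a w β ξ = 0 := by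
  have h0 := compactWindow_eq a w hβ ξ 0
  rw [Int.cast_zero, mul_zero, sub_zero, sub_zero] at h0
  rw [h0]
  refine Finset.sum_eq_zero fun k _ => ?_
  rw [intCoeff_eq_zero, mul_zero]
  have hpos := cellIndex_offset_pos hβ ξ
  have hle := cellIndex_offset_le hβ ξ
  rcases h with h | h
  · left
    have : (cellIndex β ξ : ℝ) < 0 := by
      by_contra! hc
      nlinarith
    exact_mod_cast this
  · right
    have h1 : (N : ℝ) < cellIndex β ξ + 1 := by
      by_contra! hc
      nlinarith
    have h2 : (N : ℤ) < cellIndex β ξ + 1 := by exact_mod_cast h1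
    have h3 := natDegree_geomPoly_le (Finset.univ.erase k) fun k => decayRatio β (w k)
    rw [Finset.card_erase_of_mem (Finset.mem_univ k), Finset.card_fin] at h3
    have := k.pos
    omega

theorem exists_norm_compactWindow_le {N : ℕ} (a w : Fin N → ℂ) (β : ℝ) :
    ∃ C, ∀ ξ, ‖compactWindow a w β ξ‖ ≤ C := by
  obtain ⟨C, hC⟩ := exists_norm_freqWindow_le a w
  refine ⟨∑ r ∈ Finset.range (N + 1),
    ‖(geomPoly Finset.univ fun k => decayRatio β (w k)).coeff r‖ * C,
    fun ξ => norm_sum_le_of_le _ fun r _ => ?_⟩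
  rw [norm_mul]
  exact mul_le_mul_of_nonneg_left (hC _) (norm_nonneg _)

theorem intCoeff_sum {ι : Type*} (s : Finset ι) (p : ι → ℂ[X]) (d : ℤ) :
    intCoeff (∑ k ∈ s, p k) d = ∑ k ∈ s, intCoeff (p k) d := by
  unfold intCoeff
  split_ifs <;> simp

theorem intCoeff_C_mul (c : ℂ) (p : ℂ[X]) (d : ℤ) : intCoeff (C c * p) d = c * intCoeff p d := by
  unfold intCoeff
  split_ifs <;> simp

/-! ### Uniqueness for the fiber equations. -/

/-- Uniqueness in the critical case: the period equals the translation step. -/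
theorem eq_zero_of_tsum_compactWindow_eq_zero_of_tendsto {N : ℕ} (hN : 1 ≤ N) {a w : Fin N → ℂ}
    (ha : ∀ k, a k ≠ 0) (hdist : ∀ k l, k ≠ l → (w k).re ≠ (w l).re) {β : ℝ} (hβ : 0 < β)
    (x : ℝ) {y : ℤ → ℂ} (hy : Tendsto y cofinite (𝓝 0))
    (h : ∀ j : ℤ, ∑' n : ℤ, y n * compactWindow a w β (x + n * β - β * j) = 0) : y = 0 := by
  set q : Fin N → ℂ := fun k => decayRatio β (w k) with hq
  set c : Fin N → ℂ := fun k => 2 * Real.pi * Complex.I * a k *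
    Complex.exp (-(2 * Real.pi * w k) * (x - β * cellIndex β x : ℝ)) with hc
  have hc0 : ∀ k, c k ≠ 0 := fun k => by
    have hpi : (Real.pi : ℂ) ≠ 0 := by exact_mod_cast Real.pi_ne_zero
    simp [hc, hpi, ha k, Complex.exp_ne_zero]
  set P : ℂ[X] := ∑ k, C (c k) * geomPoly (Finset.univ.erase k) q with hP
  have hqinj : Function.Injective q := fun k l hkl =>
    decayRatio_norm_injective hdist hβ (congrArg norm hkl)
  have hroot := geomPoly_eval_inv (ι := Fin N) (q := q) (hq := fun l => decayRatio_ne_zero _ _)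
    (hinj := hqinj)
  -- At the inverse of the first ratio every other summand of `P` vanishes.
  have hP0 : P ≠ 0 := by
    intro h0
    have h1 := congrArg (eval (q ⟨0, hN⟩)⁻¹) h0
    rw [hP, eval_finsetSum, Finset.sum_eq_single_of_mem ⟨0, hN⟩ (Finset.mem_univ _), eval_mul,
      eval_C, eval_zero, mul_eq_zero] at h1
    · rcases h1 with h1 | h1
      · exact hc0 _ h1
      · exact Finset.notMem_erase _ _ ((hroot _ _).mp h1)
    · intro k _ hk
      rw [eval_mul, (hroot _ _).mpr (Finset.mem_erase.mpr ⟨hk.symm, Finset.mem_univ _⟩), mul_zero]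
  refine eq_zero_of_aeval_seqShift_eq_zero hP0 hy ?_
  ext i
  rw [← tsum_mul_intCoeff, Pi.zero_apply, ← h (i + cellIndex β x)]
  refine tsum_congr fun n => ?_
  have h2 : x + n * β - β * ((i + cellIndex β x : ℤ) : ℝ) = x - β * ((i + cellIndex β x - n : ℤ) : ℝ) := by
    push_cast; ring
  rw [h2, compactWindow_eq a w hβ, hP, intCoeff_sum]
  congr 1
  refine Finset.sum_congr rfl fun k _ => ?_
  rw [intCoeff_C_mul, show cellIndex β x - (i + cellIndex β x - n) = n - i by ring]

theorem cellIndex_strictMono {β γ : ℝ} (hβ : 0 < β) (hγ : β ≤ γ) (x : ℝ) :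
    StrictMono fun n : ℤ => cellIndex β (x + n * γ) := by
  refine strictMono_int_of_lt_succ fun n => ?_
  have h1 := cellIndex_offset_pos hβ (x + n * γ)
  have h2 := cellIndex_offset_le hβ (x + (n + 1 : ℤ) * γ)
  push_cast at h2
  have h3 : (cellIndex β (x + n * γ) : ℝ) < cellIndex β (x + (n + 1 : ℤ) * γ) := by
    push_cast
    by_contra! hc
    nlinarith
  exact_mod_cast h3

/-- If every large index were hit, the cell index would eventually grow by exactly one per step; but
the points advance by `γ > β` and would outrun their cells. -/
theorem frequently_cellIndex_ne {β γ : ℝ} (hβ : 0 < β) (hγ : β < γ) (x : ℝ) :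
    ∃ᶠ n : ℕ in atTop, ∀ j : ℤ, cellIndex β (x + j * γ) ≠ n := by
  intro hev
  obtain ⟨n₀, hn₀⟩ := eventually_atTop.mp hev
  simp only [not_forall, not_not] at hn₀
  have hmono := cellIndex_strictMono hβ hγ.le x
  obtain ⟨j₀, hj₀⟩ := hn₀ n₀ le_rfl
  have hlin : ∀ m : ℕ, cellIndex β (x + ((j₀ + m : ℤ) : ℝ) * γ) = n₀ + m := fun m => by
    induction m with
    | zero => simpa using hj₀
    | succ m ih =>
      obtain ⟨j, hj⟩ := hn₀ (n₀ + (m + 1)) (by omega)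
      have h1 : j₀ + m < j := by
        rw [← hmono.lt_iff_lt]
        simp only [ih, hj]
        push_cast; omega
      have h2 := hmono.monotone (show j₀ + ((m + 1 : ℕ) : ℤ) ≤ j by push_cast; omega)
      have h3 := hmono (show j₀ + (m : ℤ) < j₀ + ((m + 1 : ℕ) : ℤ) by push_cast; omega)
      simp only [ih, hj] at h2 h3
      push_cast at h2 h3 ⊢
      omega
  obtain ⟨m, hm⟩ := exists_nat_gt ((β * (n₀ + 1) - x - j₀ * γ) / (γ - β))
  rw [div_lt_iff₀ (by linarith)] at hm
  have h1 := cellIndex_offset_le hβ (x + ((j₀ + m : ℤ) : ℝ) * γ)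
  rw [hlin m] at h1
  push_cast at h1
  nlinarith

/-- For almost every `x`, every finite window matrix with injective limit is itself injective.
The columns are normalized by the exponential with index `k₁`. -/
theorem ae_forall_windowMatrix_injective {N : ℕ} {a w : Fin N → ℂ} (ha : ∀ k, a k ≠ 0)
    {k₁ : Fin N} (hk₁ : ∀ k, k ≠ k₁ → (w k₁).re < (w k).re) (β γ : ℝ) (p : Fin N → ℂ[X]) :
    ∀ᵐ x : ℝ, ∀ (K : ℕ) (d : Finset.Icc (-K : ℤ) K → ℤ) (b b' : ℤ),
      (∀ v : Finset.Icc (-K : ℤ) K → ℂ, (∀ i ∈ Finset.Ioo b b',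
        ∑ n, v n * intCoeff (p k₁) (d n - i) = 0) → v = 0) →
      ∀ v : Finset.Icc (-K : ℤ) K → ℂ, (∀ i ∈ Finset.Ioo b b',
        ∑ n, v n * ∑ k, a k / a k₁ *
          Complex.exp (-(2 * Real.pi * (w k - w k₁)) * (x + n * γ - β * d n : ℝ)) *
            intCoeff (p k) (d n - i) = 0) → v = 0 := by
  -- There are countably many patterns `(K, d, b, b')`, so each may be treated separately, with `d`
  -- independent of `x`.
  simp only [ae_all_iff]
  intro K d b b' h
  let E : ℝ → Matrix (Finset.Ioo b b') (Finset.Icc (-K : ℤ) K) ℂ := fun x i n =>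
    ∑ k, a k / a k₁ *
      Complex.exp (-(2 * Real.pi * (w k - w k₁)) * (x + n * γ - β * d n : ℝ)) *
        intCoeff (p k) (d n - i)
  let E₀ : Matrix (Finset.Ioo b b') (Finset.Icc (-K : ℤ) K) ℂ := fun i n =>
    intCoeff (p k₁) (d n - i)
  have hana : ∀ i n, AnalyticOnNhd ℝ (fun x => E x i n) Set.univ := fun i n => by
    refine Finset.analyticOnNhd_fun_sum _ fun k _ => ?_
    refine (analyticOnNhd_const.mul ?_).mul analyticOnNhd_const
    refine (analyticOnNhd_cexp.restrictScalars (𝕜 := ℝ)).comp (t := Set.univ) ?_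
      (fun _ _ => trivial)
    refine analyticOnNhd_const.mul ?_
    refine (Complex.ofRealCLM.analyticOnNhd _).comp (t := Set.univ) ?_ (fun _ _ => trivial)
    exact (analyticOnNhd_id.add analyticOnNhd_const).sub analyticOnNhd_const
  have hlim : ∀ i n, Tendsto (fun x => E x i n) atTop (𝓝 (E₀ i n)) := fun i n => by
    have hsum : E₀ i n = ∑ k, (if k = k₁ then E₀ i n else 0) := by simp
    rw [hsum]
    refine tendsto_finsetSum _ fun k _ => ?_
    split_ifs with hk
    · subst hk
      simp [E₀, div_self (ha k)]
    · rw [show (0 : ℂ) = a k / a k₁ * 0 * intCoeff (p k) (d n - i) by ring]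
      refine (Tendsto.const_mul _ ?_).mul_const _
      rw [Complex.tendsto_exp_nhds_zero_iff]
      have hre : ∀ x : ℝ, (-(2 * Real.pi * (w k - w k₁)) * (x + n * γ - β * d n : ℝ)).re =
          -(2 * Real.pi * ((w k).re - (w k₁).re)) * (x + (n * γ - β * d n)) := fun x => by
        rw [Complex.re_mul_ofReal]
        simp only [Complex.neg_re, Complex.mul_re, Complex.re_ofNat, Complex.im_ofNat,
          Complex.ofReal_re, Complex.ofReal_im, Complex.sub_re, Complex.mul_im]
        ring
      simp only [hre]
      refine Tendsto.const_mul_atTop_of_neg ?_ (tendsto_atTop_add_const_right _ _ tendsto_id)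
      have := mul_pos Real.two_pi_pos (sub_pos.mpr (hk₁ k hk))
      linarith
  have h₀ : ∀ v, E₀.mulVec v = 0 → v = 0 := fun v hv => h v fun i hi => by
    have := congrFun hv ⟨i, hi⟩
    simp only [Matrix.mulVec, dotProduct, Pi.zero_apply] at this
    rw [← this]
    exact Finset.sum_congr rfl fun n _ => mul_comm _ _
  filter_upwards [ae_mulVec_injective_of_tendsto hana hlim h₀] with x hx v hv
  refine hx v (funext fun i => ?_)
  exact (Finset.sum_congr rfl fun n _ => mul_comm (E x i n) (v n)).trans (hv i i.2)

/-- Uniqueness in the oversampled case, without any growth restriction. -/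
theorem ae_eq_zero_of_tsum_compactWindow_eq_zero {N : ℕ} (hN : 1 ≤ N) {a w : Fin N → ℂ}
    (ha : ∀ k, a k ≠ 0) (hdist : ∀ k l, k ≠ l → (w k).re ≠ (w l).re) {β γ : ℝ} (hβ : 0 < β)
    (hγ : β < γ) : ∀ᵐ x : ℝ, ∀ y : ℤ → ℂ,
      (∀ j : ℤ, ∑' n : ℤ, y n * compactWindow a w β (x + n * γ - β * j) = 0) → y = 0 := by
  obtain ⟨k₁, -, hmin⟩ := Finset.exists_min_image Finset.univ (fun k => (w k).re)
    ⟨(⟨0, hN⟩ : Fin N), Finset.mem_univ _⟩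
  have hk₁ : ∀ k, k ≠ k₁ → (w k₁).re < (w k).re := fun k hk =>
    lt_of_le_of_ne (hmin k (Finset.mem_univ _)) (hdist _ _ hk.symm)
  set q : Fin N → ℂ := fun k => decayRatio β (w k) with hq
  filter_upwards [ae_forall_windowMatrix_injective ha hk₁ β γ
    fun k => geomPoly (Finset.univ.erase k) q] with x hx y hy
  set d : ℤ → ℤ := fun n => cellIndex β (x + n * γ) with hd
  have hmono : StrictMono d := cellIndex_strictMono hβ hγ.le x
  obtain ⟨K₀, hK₀⟩ := exists_window_eq_zero_of_sum_intCoeff_eq_zero (Finset.univ.erase k₁)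
    (fun l => decayRatio_ne_zero β (w l)) (decayRatio_norm_injective hdist hβ) hmono
    (frequently_cellIndex_ne hβ hγ x)
  set off : ℤ → ℝ := fun n => x + n * γ - β * d n with hoff
  have hcard : ∀ k : Fin N, (Finset.univ.erase k).card = N - 1 := fun k => by
    rw [Finset.card_erase_of_mem (Finset.mem_univ k), Finset.card_fin]
  ext m
  set K : ℕ := max K₀ m.natAbs with hK
  have hm : m ∈ Finset.Icc (-K : ℤ) K := by
    have := le_max_right K₀ m.natAbs
    rw [Finset.mem_Icc]; omega
  -- A row `i` involves only cells with `0 ≤ d n - i ≤ N - 1`. These endpoints select rows that see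
  -- no column outside `[-K, K]`, so the infinite system yields a closed finite one.
  have hinj := hx K (fun n => d n) (d (-K - 1)) (d (K + 1) - (N - 1 : ℕ)) fun v hv => by
    have := hK₀ K (le_max_left _ _) (fun n => if hn : n ∈ Finset.Icc (-K : ℤ) K then v ⟨n, hn⟩ else 0)
      fun i h1 h2 => by
        rw [hcard] at h2
        rw [← hv i (Finset.mem_Ioo.mpr ⟨h1, by omega⟩)]
        refine (Finset.sum_coe_sort _ _).symm.trans (Finset.sum_congr rfl fun n _ => ?_)
        rw [dif_pos n.2]
    ext n
    simpa using this n n.2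
  set v : ℤ → ℂ := fun n => y n * (2 * Real.pi * Complex.I * a k₁ *
    Complex.exp (-(2 * Real.pi * w k₁) * off n)) with hv
  have hv0 := hinj (fun n => v n) fun i hi => by
    obtain ⟨h1, h2⟩ := Finset.mem_Ioo.mp hi
    rw [← hy i, tsum_eq_sum (s := Finset.Icc (-K : ℤ) K)]
    · refine Eq.trans (Finset.sum_congr rfl fun n _ => ?_) (Finset.sum_coe_sort _ _)
      rw [compactWindow_eq a w hβ, hv]
      simp only
      rw [mul_assoc (y n), Finset.mul_sum]
      congr 1
      refine Finset.sum_congr rfl fun k _ => ?_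
      have hexp : Complex.exp (-(2 * Real.pi * w k) * off n) =
          Complex.exp (-(2 * Real.pi * w k₁) * off n) *
            Complex.exp (-(2 * Real.pi * (w k - w k₁)) * off n) := by
        rw [← Complex.exp_add]; congr 1; ring
      change 2 * Real.pi * Complex.I * a k₁ * Complex.exp (-(2 * Real.pi * w k₁) * off n) *
          (a k / a k₁ * Complex.exp (-(2 * Real.pi * (w k - w k₁)) * off n) *
            intCoeff (geomPoly (Finset.univ.erase k) q) (d n - i)) =
        2 * Real.pi * Complex.I * a k * Complex.exp (-(2 * Real.pi * w k) * off n) *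
          intCoeff (geomPoly (Finset.univ.erase k) q) (d n - i)
      rw [hexp]
      have := ha k₁
      field_simp
    · intro n hn
      rw [compactWindow_eq a w hβ]
      refine mul_eq_zero_of_right _ (Finset.sum_eq_zero fun k _ => ?_)
      rw [intCoeff_eq_zero, mul_zero]
      have hdeg := natDegree_geomPoly_le (Finset.univ.erase k) fun k => decayRatio β (w k)
      rw [hcard] at hdeg
      rw [Finset.mem_Icc] at hn
      change d n - i < 0 ∨ _ < d n - i
      by_cases hn' : n < -K
      · left
        have := hmono.monotone (show n ≤ -K - 1 by omega)
        omega
      · right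
        have := hmono.monotone (show (K : ℤ) + 1 ≤ n by omega)
        omega
  have hfin := congrFun hv0 ⟨m, hm⟩
  have hpi : (Real.pi : ℂ) ≠ 0 := by exact_mod_cast Real.pi_ne_zero
  simpa [hv, hpi, ha k₁, Complex.exp_ne_zero] using hfin

/-! ### From fibers to functions: completeness for `α * β ≤ 1`. -/

/-- The fibers `n ↦ H (x + n T)` of an `L²` function tend to zero for almost every `x`. -/
theorem ae_tendsto_fiber_of_memLp_two (T : ℝ) {H : ℝ → ℂ} (hH : MemLp H 2 volume) :
    ∀ᵐ x, x ∈ Set.Ioc 0 T → Tendsto (fun n : ℤ => H (x + n * T)) cofinite (𝓝 0) := by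
  set f : ℝ → ENNReal := fun x => ‖H x‖ₑ ^ 2 with hf
  have hfm : AEMeasurable f volume := hH.1.enorm.pow_const 2
  have hfin : ∫⁻ x, f x < ⊤ := by
    have := lintegral_rpow_enorm_lt_top_of_eLpNorm_lt_top (by norm_num) (by norm_num) hH.2
    simpa [hf] using this
  have hshift : ∀ n : ℤ, MeasurePreserving (fun x : ℝ => x + n * T) volume volume :=
    fun n => measurePreserving_add_right volume _
  have hpart : ∀ n : ℤ, ∫⁻ x in Set.Ioc 0 T, f (x + n * T) =
      ∫⁻ x in Set.Ioc (0 + n • T) (0 + (n + 1) • T), f x := fun n => by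
    refine Eq.trans ?_ ((hshift n).setLIntegral_comp_preimage_emb (measurableEmbedding_addRight _) f _)
    congr 2
    ext x
    simp only [zsmul_eq_mul, zero_add, Set.mem_preimage, Set.mem_Ioc, Int.cast_add, Int.cast_one]
    constructor <;> rintro ⟨h1, h2⟩ <;> constructor <;> linarith
  have hmeas : ∀ n : ℤ, AEMeasurable (fun x => f (x + n * T)) (volume.restrict (Set.Ioc 0 T)) :=
    fun n => (hfm.comp_quasiMeasurePreserving (hshift n).quasiMeasurePreserving).restrict
  -- Integrating the square sums of the fibers over one period gives the squared L² norm of `H`, so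
  -- almost every fiber is square summable.
  have hsum : ∫⁻ x in Set.Ioc 0 T, ∑' n : ℤ, f (x + n * T) ≠ ⊤ := by
    rw [lintegral_tsum hmeas]
    simp_rw [hpart]
    rw [← lintegral_iUnion (fun n => measurableSet_Ioc) (Set.pairwise_disjoint_Ioc_add_zsmul 0 T)]
    exact ((setLIntegral_le_lintegral _ _).trans_lt hfin).ne
  have hae := ae_lt_top' (AEMeasurable.tsum hmeas) hsum
  rw [ae_restrict_iff' measurableSet_Ioc] at hae
  filter_upwards [hae] with x hx hxT
  have h1 := ENNReal.tendsto_cofinite_zero_of_tsum_ne_top (hx hxT).ne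
  rw [tendsto_zero_iff_norm_tendsto_zero]
  have h2 : Tendsto (fun n : ℤ => ‖H (x + n * T)‖ ^ 2) cofinite (𝓝 0) := by
    have := (ENNReal.tendsto_toReal ENNReal.zero_ne_top).comp h1
    simpa [hf, Function.comp_def] using this
  have h3 := (Real.continuous_sqrt.tendsto 0).comp h2
  simpa [Function.comp_def, Real.sqrt_sq (norm_nonneg _)] using h3

theorem ae_eq_zero_of_ae_fiber_eq_zero {T : ℝ} (hT : 0 < T) {H : ℝ → ℂ}
    (h : ∀ᵐ x, x ∈ Set.Ioc 0 T → ∀ n : ℤ, H (x + n * T) = 0) : H =ᵐ[volume] 0 := by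
  have h1 : ∀ n : ℤ, ∀ᵐ x : ℝ, x - n * T ∈ Set.Ioc 0 T → H x = 0 := fun n => by
    filter_upwards [(measurePreserving_sub_right volume (n * T)).quasiMeasurePreserving.ae h]
      with x hx hxT
    simpa using hx hxT n
  filter_upwards [ae_all_iff.mpr h1] with x hx
  obtain ⟨n, hn, -⟩ := existsUnique_sub_zsmul_mem_Ioc hT x 0
  exact hx n (by simpa using hn)

theorem integrable_mul_exp_mul_freqWindow {N : ℕ} (a : Fin N → ℂ) {w : Fin N → ℂ}
    (hw : ∀ k, (w k).re ≠ 0) {H : ℝ → ℂ} (hH : MemLp H 2 volume) (α b : ℝ) (m : ℤ) :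
    Integrable fun ξ : ℝ => H ξ * (Complex.exp (2 * Real.pi * Complex.I * (α * m) * ξ) *
      freqWindow a w (ξ + b)) := by
  obtain ⟨C, hC⟩ := exists_norm_freqWindow_le a w
  have h1 : Integrable fun ξ : ℝ => H ξ * freqWindow a w (ξ + b) :=
    hH.integrable_mul (q := 2) ((memLp_two_of_integrable_of_bounded
      (integrable_freqWindow a w hw) hC).comp_measurePreserving
        (measurePreserving_add_right volume b))
  have h2 := h1.bdd_mul (c := 1) (by fun_prop : Continuous fun ξ : ℝ =>
    Complex.exp (2 * Real.pi * Complex.I * (α * m) * ξ)).aestronglyMeasurable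
    (Eventually.of_forall fun ξ => by rw [Complex.norm_exp]; simp)
  refine h2.congr (Eventually.of_forall fun ξ => ?_)
  simp only
  ring

theorem integral_mul_compactWindow_eq_zero {N : ℕ} {a w : Fin N → ℂ} (hw : ∀ k, (w k).re ≠ 0)
    {α β : ℝ} {H : ℝ → ℂ} (hH : MemLp H 2 volume)
    (h : ∀ m n : ℤ, ∫ ξ : ℝ, H ξ * (Complex.exp (2 * Real.pi * Complex.I * (α * m) * ξ) *
      freqWindow a w (ξ + β * n)) = 0) (m j : ℤ) :
    ∫ ξ : ℝ, H ξ * compactWindow a w β (ξ - β * j) *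
      Complex.exp (2 * Real.pi * Complex.I * (α * m) * ξ) = 0 := by
  have hint := fun n : ℤ => integrable_mul_exp_mul_freqWindow a hw hH α (β * n) m
  have hexpand : ∀ ξ : ℝ, H ξ * compactWindow a w β (ξ - β * j) *
      Complex.exp (2 * Real.pi * Complex.I * (α * m) * ξ) =
      ∑ r ∈ Finset.range (N + 1), (geomPoly Finset.univ fun k => decayRatio β (w k)).coeff r *
        (H ξ * (Complex.exp (2 * Real.pi * Complex.I * (α * m) * ξ) *
        freqWindow a w (ξ + β * (-(j + r) : ℤ)))) := fun ξ => by
    rw [compactWindow, Finset.mul_sum, Finset.sum_mul]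
    refine Finset.sum_congr rfl fun r _ => ?_
    rw [show ξ + β * ((-(j + r) : ℤ) : ℝ) = ξ - β * j - β * r by push_cast; ring]
    ring
  simp_rw [hexpand]
  rw [integral_finsetSum _ fun r _ => (hint _).const_mul _]
  exact Finset.sum_eq_zero fun r _ => by rw [integral_const_mul, h, mul_zero]

theorem aestronglyMeasurable_compactWindow {N : ℕ} (a w : Fin N → ℂ) (hw : ∀ k, (w k).re ≠ 0)
    (β : ℝ) : AEStronglyMeasurable (compactWindow a w β) volume :=
  Finset.aestronglyMeasurable_fun_sum _ fun _ _ =>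
    ((integrable_freqWindow a w hw).comp_sub_right _).1.const_mul _

/-- The compact support of the window reduces the periodization to a finite sum, although `H` itself
is arbitrary in L². -/
theorem ae_tsum_compactWindow_eq_zero {N : ℕ} {a w : Fin N → ℂ} (hw : ∀ k, (w k).re ≠ 0)
    {α β : ℝ} (hα : 0 < α) (hβ : 0 < β) {H : ℝ → ℂ} (hH : MemLp H 2 volume)
    (h : ∀ m n : ℤ, ∫ ξ : ℝ, H ξ * (Complex.exp (2 * Real.pi * Complex.I * (α * m) * ξ) *
      freqWindow a w (ξ + β * n)) = 0) (j : ℤ) :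
    ∀ᵐ x, x ∈ Set.Ioc 0 α⁻¹ → ∑' n : ℤ, H (x + n * α⁻¹) *
      compactWindow a w β (x + n * α⁻¹ - β * j) = 0 := by
  obtain ⟨C, hC⟩ := exists_norm_compactWindow_le a w β
  have hT : 0 < α⁻¹ := inv_pos.mpr hα
  obtain ⟨L, hL⟩ := exists_nat_gt ((β * |(j : ℝ)| + β * N) / α⁻¹)
  rw [div_lt_iff₀ hT] at hL
  refine ae_tsum_eq_zero_of_fourier_integral_eq_zero hT (L := L)
    (F := fun ξ => H ξ * compactWindow a w β (ξ - β * j)) ?_ ?_ fun m => ?_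
  · refine hH.of_le_mul (c := C) (hH.1.mul ?_) (Eventually.of_forall fun ξ => ?_)
    · exact (aestronglyMeasurable_compactWindow a w hw β).comp_measurePreserving
        (measurePreserving_sub_right volume (β * j))
    · rw [norm_mul, mul_comm]
      exact mul_le_mul_of_nonneg_right (hC _) (norm_nonneg _)
  · intro ξ hξ
    have hne := right_ne_zero_of_mul hξ
    have h1 : 0 < ξ - β * j ∧ ξ - β * j ≤ β * N := by
      by_contra! hc
      refine hne (compactWindow_eq_zero a w hβ ?_)
      by_cases h0 : 0 < ξ - β * j
      · exact Or.inr (hc h0)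
      · exact Or.inl (not_lt.mp h0)
    have h2 := mul_le_mul_of_nonneg_left (neg_abs_le (j : ℝ)) hβ.le
    have h3 := mul_le_mul_of_nonneg_left (le_abs_self (j : ℝ)) hβ.le
    have h4 : 0 ≤ β * N := by positivity
    constructor <;> linarith [h1.1, h1.2]
  · rw [← integral_mul_compactWindow_eq_zero hw hH h m j]
    refine integral_congr_ae (Eventually.of_forall fun ξ => ?_)
    simp only
    congr 2
    push_cast
    rw [div_inv_eq_mul]
    ring

theorem ae_eq_zero_of_orthogonal {N : ℕ} (hN : 1 ≤ N) {a w : Fin N → ℂ} (ha : ∀ k, a k ≠ 0)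
    (hw : ∀ k, (w k).re ≠ 0) (hdist : ∀ k l, k ≠ l → (w k).re ≠ (w l).re)
    {α β : ℝ} (hα : 0 < α) (hβ : 0 < β) (hαβ : α * β ≤ 1) {H : ℝ → ℂ} (hH : MemLp H 2 volume)
    (h : ∀ m n : ℤ, ∫ ξ : ℝ, H ξ * (Complex.exp (2 * Real.pi * Complex.I * (α * m) * ξ) *
      freqWindow a w (ξ + β * n)) = 0) : H =ᵐ[volume] 0 := by
  have hT : 0 < α⁻¹ := inv_pos.mpr hα
  refine ae_eq_zero_of_ae_fiber_eq_zero hT ?_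
  have hsum := ae_all_iff.mpr (ae_tsum_compactWindow_eq_zero hw hα hβ hH h)
  have hle : β ≤ α⁻¹ := by rw [← one_div, le_div_iff₀ hα]; linarith
  -- Decay of the fibers is needed only at the critical density.
  rcases hle.lt_or_eq with hlt | heq
  · filter_upwards [hsum, ae_eq_zero_of_tsum_compactWindow_eq_zero hN ha hdist hβ hlt]
      with x hx huniq hxT n
    exact congrFun (huniq (fun n => H (x + n * α⁻¹)) fun j => hx j hxT) n
  · filter_upwards [hsum, ae_tendsto_fiber_of_memLp_two α⁻¹ hH] with x hx htend hxT n
    rw [← heq] at hx htend hxT ⊢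
    exact congrFun (eq_zero_of_tsum_compactWindow_eq_zero_of_tendsto hN ha hdist hβ x
      (htend hxT) fun j => hx j hxT) n

/-! ### Incompleteness for `α * β > 1`. -/

/-- The ring of complex-valued real-analytic functions on the line. -/
def analyticSubring : Subring (ℝ → ℂ) where
  carrier := {f | AnalyticOnNhd ℝ f Set.univ}
  mul_mem' := AnalyticOnNhd.mul
  one_mem' := analyticOnNhd_const
  add_mem' := AnalyticOnNhd.add
  zero_mem' := analyticOnNhd_const
  neg_mem' := AnalyticOnNhd.neg

/-- An underdetermined homogeneous linear system with analytic coefficients has a nontrivial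
analytic solution. -/
theorem exists_analytic_kernel {R S : Type*} [Fintype R] [Fintype S]
    (hcard : Fintype.card R < Fintype.card S) {E : R → S → ℝ → ℂ}
    (hE : ∀ i s, AnalyticOnNhd ℝ (E i s) Set.univ) :
    ∃ v : S → ℝ → ℂ, (∀ s, AnalyticOnNhd ℝ (v s) Set.univ) ∧ (∃ s x, v s x ≠ 0) ∧
      ∀ x i, ∑ s, v s x * E i s x = 0 := by
  let M : Matrix R S analyticSubring := fun i s => ⟨E i s, hE i s⟩
  -- Over a nontrivial commutative ring no injective linear map goes to a free module of smaller
  -- rank.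
  have hninj : ¬ Function.Injective M.mulVecLin := fun h =>
    hcard.not_ge (card_le_of_injective analyticSubring M.mulVecLin h)
  rw [← LinearMap.ker_eq_bot, Submodule.eq_bot_iff] at hninj
  push Not at hninj
  obtain ⟨v, hv, hv0⟩ := hninj
  refine ⟨fun s => (v s : ℝ → ℂ), fun s => (v s).2, ?_, fun x i => ?_⟩
  · obtain ⟨s, hs⟩ := Function.ne_iff.mp hv0
    have hs' : (v s : ℝ → ℂ) ≠ 0 := fun h => hs (Subtype.ext h)
    obtain ⟨x, hx⟩ := Function.ne_iff.mp hs'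
    exact ⟨s, x, hx⟩
  · have h1 : (M.mulVec v) i = 0 := congrFun hv i
    have h2 := congrFun (congrArg (Subtype.val : analyticSubring → ℝ → ℂ) h1) x
    simp only [Matrix.mulVec, dotProduct, AddSubmonoidClass.coe_finsetSum, Finset.sum_apply] at h2
    exact (Finset.sum_congr rfl fun s _ => mul_comm _ _).trans h2

theorem analyticOnNhd_exp_affine (c : ℂ) (b : ℝ) :
    AnalyticOnNhd ℝ (fun x : ℝ => Complex.exp (c * (x + b : ℝ))) Set.univ := by
  refine (analyticOnNhd_cexp.restrictScalars (𝕜 := ℝ)).comp (t := Set.univ) ?_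
    (fun _ _ => trivial)
  refine analyticOnNhd_const.mul ?_
  exact (Complex.ofRealCLM.analyticOnNhd _).comp (t := Set.univ)
    (analyticOnNhd_id.add analyticOnNhd_const) (fun _ _ => trivial)

/-- If the period is smaller than the translation step, some nontrivial analytic combination
annihilates all translates of `freqWindow` on a left neighbourhood of the origin. -/
theorem exists_analytic_annihilator {N : ℕ} (a w : Fin N → ℂ) {β T : ℝ} (hT : 0 < T)
    (hTβ : T < β) : ∃ (L : ℕ) (v : Fin L → ℝ → ℂ), (∀ n, AnalyticOnNhd ℝ (v n) Set.univ) ∧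
      (∃ n x, v n x ≠ 0) ∧ ∀ᶠ x in 𝓝[≤] (0 : ℝ), ∀ j : ℤ,
        ∑ n, v n x * freqWindow a w (x + n * T + β * j) = 0 := by
  have hβ : 0 < β := hT.trans hTβ
  have hr : 0 < 1 - T / β := by rw [sub_pos, div_lt_one hβ]; exact hTβ
  -- This size of `L` gives `N + ⌈L * T / β⌉ < L`: fewer conditions than unknowns.
  obtain ⟨L, hL⟩ := exists_nat_gt ((N + 1) / (1 - T / β))
  rw [div_lt_iff₀ hr] at hL
  set D : Fin L → ℤ := fun n => ⌈n * T / β⌉ with hD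
  set B : ℕ := ⌈L * T / β⌉.toNat with hB
  have hB0 : 0 ≤ ⌈L * T / β⌉ := Int.ceil_nonneg (by positivity)
  have hD0 : ∀ n, 0 ≤ D n := fun n => Int.ceil_nonneg (by positivity)
  have hDB : ∀ n, D n ≤ B := fun n => by
    rw [hB, Int.toNat_of_nonneg hB0]
    refine Int.ceil_le_ceil ?_
    have : ((n : ℕ) : ℝ) ≤ L := by exact_mod_cast n.2.le
    gcongr
  have hcard : N + B < L := by
    have h1 := Int.ceil_lt_add_one (L * T / β)
    have h2 : (B : ℝ) = ⌈L * T / β⌉ := by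
      rw [hB]; exact_mod_cast Int.toNat_of_nonneg hB0
    have h3 : ((N + B : ℕ) : ℝ) < L := by
      push_cast
      rw [h2]
      have : L * (1 - T / β) = L - L * T / β := by ring
      linarith
    exact_mod_cast h3
  -- The first `N` rows are moment conditions, one per exponential. The other `B` rows are the
  -- translates `j = -i`, with the half-line switches frozen at their values just left of `x = 0`,
  -- which makes the entries analytic.
  let E : Fin N ⊕ Fin B → Fin L → ℝ → ℂ := Sum.elim
    (fun k n x => Complex.exp (-(2 * Real.pi * w k) * (x + n * T : ℝ)))
    (fun i n x => ∑ k, 2 * Real.pi * Complex.I * a k *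
      (((if (i : ℤ) < D n then 1 else 0) - (if 0 < (w k).re then 0 else 1)) *
        Complex.exp (-(2 * Real.pi * w k) * (x + (n * T - β * i) : ℝ))))
  obtain ⟨v, hv, hv0, hker⟩ := exists_analytic_kernel (E := E) (by simpa using hcard) (by
    rintro (k | i) n
    · exact analyticOnNhd_exp_affine _ _
    · exact Finset.analyticOnNhd_fun_sum _ fun k _ => analyticOnNhd_const.mul
        (analyticOnNhd_const.mul (analyticOnNhd_exp_affine _ _)))
  refine ⟨L, v, hv, hv0, ?_⟩
  -- The ceiling is locally constant to the left of every point, so the frozen switches are correct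
  -- there.
  have hceil : ∀ᶠ x in 𝓝[≤] (0 : ℝ), ∀ n : Fin L, ⌈(x + n * T) / β⌉ = D n := by
    refine eventually_all.mpr fun n => ?_
    have h1 : Tendsto (fun x : ℝ => (x + n * T) / β) (𝓝[≤] 0) (𝓝[≤] (n * T / β)) := by
      refine tendsto_nhdsWithin_iff.mpr ⟨?_, ?_⟩
      · have : Continuous fun x : ℝ => (x + n * T) / β := by fun_prop
        simpa using (this.tendsto 0).mono_left nhdsWithin_le_nhds
      · filter_upwards [self_mem_nhdsWithin] with x hx
        have hx' : x ≤ 0 := hx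
        change (x + n * T) / β ≤ n * T / β
        gcongr
        linarith
    exact tendsto_pure.mp ((tendsto_ceil_left_pure_ceil (n * T / β : ℝ)).comp h1)
  filter_upwards [hceil] with x hx j
  have hmoment : ∀ k, ∑ n, v n x * Complex.exp (-(2 * Real.pi * w k) * (x + n * T : ℝ)) = 0 :=
    fun k => hker x (Sum.inl k)
  have hwin : ∀ n : Fin L, freqWindow a w (x + n * T + β * j) = ∑ k, 2 * Real.pi * Complex.I * a k *
      (((if -j < D n then 1 else 0) - (if 0 < (w k).re then 0 else 1)) *
        Complex.exp (-(2 * Real.pi * w k) * (x + n * T + β * j : ℝ))) := fun n => by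
    refine Finset.sum_congr rfl fun k _ => ?_
    have hiff : 0 < x + n * T + β * j ↔ -j < D n := by
      rw [← hx n, Int.lt_ceil, lt_div_iff₀ hβ]
      push_cast
      constructor <;> intro h <;> linarith
    rw [halfLineExp]
    simp only [hiff]
  -- When the switch is the same for all `n`, the sum is a combination of the vanishing moments.
  -- This covers all `j` except the `B` intermediate ones.
  have hconst : ∀ P : Prop, ∀ _ : Decidable P, (∀ n, -j < D n ↔ P) →
      ∑ n, v n x * freqWindow a w (x + n * T + β * j) = 0 := fun P _ hP => by
    simp only [hwin, hP, Finset.mul_sum]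
    rw [Finset.sum_comm]
    refine Finset.sum_eq_zero fun k _ => ?_
    refine Eq.trans ?_ (mul_eq_zero_of_right (2 * Real.pi * Complex.I * a k *
      ((if P then 1 else 0) - (if 0 < (w k).re then 0 else 1)) *
        Complex.exp (-(2 * Real.pi * w k) * (β * j : ℝ))) (hmoment k))
    rw [Finset.mul_sum]
    refine Finset.sum_congr rfl fun n _ => ?_
    have : Complex.exp (-(2 * Real.pi * w k) * (x + n * T + β * j : ℝ)) =
        Complex.exp (-(2 * Real.pi * w k) * (β * j : ℝ)) *
          Complex.exp (-(2 * Real.pi * w k) * (x + n * T : ℝ)) := by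
      rw [← Complex.exp_add]; congr 1; push_cast; ring
    rw [this]
    ring
  by_cases h1 : -j < 0
  · exact hconst True inferInstance fun n => iff_true_intro (h1.trans_le (hD0 n))
  by_cases h2 : -j < B
  · obtain ⟨i, hi⟩ := Int.eq_ofNat_of_zero_le (not_lt.mp h1)
    have hiB : i < B := by omega
    rw [← hker x (Sum.inr ⟨i, hiB⟩)]
    refine Finset.sum_congr rfl fun n _ => ?_
    rw [hwin]
    have hj : (j : ℝ) = -i := by
      have : j = -(i : ℤ) := by omega
      rw [this]; push_cast; ring
    simp only [E, Sum.elim_inr, hi, hj]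
    congr 1
    refine Finset.sum_congr rfl fun k _ => ?_
    rw [show x + n * T + β * -(i : ℝ) = x + (n * T - β * i) by ring]
  · exact hconst False inferInstance fun n => iff_false_intro fun h => h2 (h.trans_le (hDB n))

/-- The analytic solution is cut off to `(ε, 0]` and its `n`-th component moved by `n * T`. The
modulations are `T`-periodic, so they factor out and orthogonality reduces to the pointwise
annihilation. -/
theorem exists_orthogonal_ne_zero {N : ℕ} (a : Fin N → ℂ) {w : Fin N → ℂ}
    (hw : ∀ k, (w k).re ≠ 0) {α β : ℝ} (hα : 0 < α) (hαβ : 1 < α * β) :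
    ∃ H : ℝ → ℂ, MemLp H 2 volume ∧ (∀ m n : ℤ, ∫ ξ : ℝ, H ξ *
      (Complex.exp (2 * Real.pi * Complex.I * (α * m) * ξ) * freqWindow a w (ξ + β * n)) = 0) ∧
      ¬ H =ᵐ[volume] 0 := by
  set T : ℝ := α⁻¹ with hTdef
  have hT : 0 < T := inv_pos.mpr hα
  have hTβ : T < β := by rw [hTdef, ← one_div, div_lt_iff₀ hα]; linarith
  obtain ⟨L, v, hv, ⟨s, x₀, hs⟩, hker⟩ := exists_analytic_annihilator a w hT hTβ
  obtain ⟨c, hc, hcker⟩ := mem_nhdsLE_iff_exists_Ioc_subset.mp hker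
  have hc0 : c < 0 := hc
  -- The bound `-T / 2` keeps the translated pieces disjoint, so they cannot cancel.
  set ε : ℝ := max c (-T / 2) with hε
  have hε0 : ε < 0 := max_lt hc0 (by linarith)
  set g : Fin L → ℝ → ℂ := fun n => (Set.Ioc ε 0).indicator (v n) with hg
  have hcont : ∀ n, Continuous (v n) := fun n => by
    have := (hv n).continuousOn
    rwa [continuousOn_univ] at this
  have hgmem : ∀ n, MemLp (g n) 2 volume := fun n => by
    obtain ⟨C, hC⟩ := isCompact_Icc.exists_bound_of_continuousOn
      (hcont n).continuousOn (s := Set.Icc ε 0)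
    refine memLp_two_of_integrable_of_bounded (C := max C 0) ?_ fun x => ?_
    · rw [hg, integrable_indicator_iff measurableSet_Ioc]
      exact ((hcont n).integrableOn_Icc).mono_set Set.Ioc_subset_Icc_self
    · by_cases hx : x ∈ Set.Ioc ε 0
      · simp only [hg, Set.indicator_of_mem hx]
        exact (hC x (Set.Ioc_subset_Icc_self hx)).trans (le_max_left _ _)
      · simp [hg, Set.indicator_of_notMem hx]
  have hterm : ∀ n : Fin L, MemLp (fun ξ => g n (ξ - n * T)) 2 volume := fun n =>
    (hgmem n).comp_measurePreserving (measurePreserving_sub_right volume (n * T))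
  refine ⟨fun ξ => ∑ n : Fin L, g n (ξ - n * T),
    memLp_finsetSum (f := fun (n : Fin L) ξ => g n (ξ - n * T)) _ fun n _ => hterm n,
    fun m j => ?_, fun h0 => ?_⟩
  · set e : ℝ → ℂ := fun ξ => Complex.exp (2 * Real.pi * Complex.I * (α * m) * ξ) with he
    have hper : ∀ (n : ℕ) (x : ℝ), e (x + n * T) = e x := fun n x => by
      refine Complex.exp_eq_exp_iff_exists_int.mpr ⟨m * n, ?_⟩
      have : (α : ℂ) ≠ 0 := by exact_mod_cast hα.ne'
      rw [hTdef]
      push_cast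
      field_simp
    have hint : ∀ n : Fin L, Integrable fun ξ : ℝ =>
        g n (ξ - n * T) * (e ξ * freqWindow a w (ξ + β * j)) := fun n =>
      integrable_mul_exp_mul_freqWindow a hw (hterm n) α (β * j) m
    have hshift : ∀ n : Fin L, (fun x : ℝ => g n x * (e x * freqWindow a w (x + n * T + β * j))) =
        fun x : ℝ => (fun ξ : ℝ => g n (ξ - n * T) * (e ξ * freqWindow a w (ξ + β * j)))
          (x + n * T) := fun n => by
      ext x
      simp only [hper, add_sub_cancel_right]
    simp only [Finset.sum_mul]
    rw [integral_finsetSum _ fun n _ => hint n]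
    have heq : ∀ n : Fin L, ∫ ξ, g n (ξ - n * T) * (e ξ * freqWindow a w (ξ + β * j)) =
        ∫ x, g n x * (e x * freqWindow a w (x + n * T + β * j)) := fun n => by
      rw [hshift, integral_add_right_eq_self
        (fun ξ : ℝ => g n (ξ - n * T) * (e ξ * freqWindow a w (ξ + β * j)))]
    simp_rw [heq]
    rw [← integral_finsetSum _ fun n _ => by rw [hshift]; exact (hint n).comp_add_right _]
    rw [← integral_zero ℝ ℂ (μ := volume)]
    congr 1
    ext x
    by_cases hx : x ∈ Set.Ioc ε 0
    · have hxc : x ∈ Set.Ioc c 0 := ⟨(le_max_left _ _).trans_lt hx.1, hx.2⟩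
      have := hcker hxc j
      simp only [hg, Set.indicator_of_mem hx]
      rw [← mul_zero (e x), ← this, Finset.mul_sum]
      exact Finset.sum_congr rfl fun n _ => by ring
    · simp [hg, Set.indicator_of_notMem hx]
  · have h1 := (measurePreserving_add_right volume (s * T : ℝ)).quasiMeasurePreserving.ae h0
    -- On the piece of index `s` only `v s` contributes, and it is nonzero almost everywhere; `H =
    -- 0` would make an interval of positive length null.
    have h2 : ∀ᵐ x : ℝ, x ∉ Set.Ioc ε 0 := by
      filter_upwards [h1, ae_ne_zero_of_analytic (hv s) hs] with x hx hvx hmem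
      apply hvx
      simp only [Pi.zero_apply] at hx
      rw [Finset.sum_eq_single_of_mem s (Finset.mem_univ _)] at hx
      · simpa [hg, Set.indicator_of_mem hmem] using hx
      · intro n _ hns
        rw [hg]
        refine Set.indicator_of_notMem (fun hn => hns ?_) _
        have h3 : -T / 2 ≤ ε := le_max_right _ _
        have h4 : ((s : ℕ) : ℝ) - (n : ℕ) < 1 := by
          by_contra! hcon
          nlinarith [hn.2, hmem.1]
        have h5 : ((n : ℕ) : ℝ) - (s : ℕ) < 1 := by
          by_contra! hcon
          nlinarith [hn.1, hmem.2]
        have h6 : (s : ℕ) < n + 1 := by exact_mod_cast (by linarith : ((s : ℕ) : ℝ) < (n : ℕ) + 1)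
        have h7 : (n : ℕ) < s + 1 := by exact_mod_cast (by linarith : ((n : ℕ) : ℝ) < (s : ℕ) + 1)
        exact Fin.ext (by omega)
    have h3 : volume (Set.Ioc ε 0) = 0 := by
      rw [← compl_compl (Set.Ioc ε 0)]
      exact mem_ae_iff.mp h2
    rw [Real.volume_Ioc, ENNReal.ofReal_eq_zero] at h3
    linarith

end

theorem mainTheorem8 {N : ℕ} (hN : 1 ≤ N) (a w : Fin N → ℂ) (ha : ∀ k, a k ≠ 0)
    (hw : ∀ k, (w k).re ≠ 0) (hdist : ∀ k l, k ≠ l → (w k).re ≠ (w l).re)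
    (α β : ℝ) (hα : 0 < α) (hβ : 0 < β) :
    IsCompleteSystem (gaborSystem (rationalWindow a w) (memLp_rationalWindow a w hw) α β) ↔
      α * β ≤ 1 := by
  rw [isCompleteSystem_gabor_iff a w hw]
  constructor
  · intro h
    by_contra! hαβ
    obtain ⟨H, hH, horth, hne⟩ := exists_orthogonal_ne_zero a hw hα hαβ
    exact hne (h H hH horth)
  · intro hαβ H hH horth
    exact ae_eq_zero_of_orthogonal hN ha hw hdist hα hβ hαβ hH horth
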